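/- Locally convex spaces and manifolds are Hausdorff. For a real locally convex space $E$ let $E_{\mathbb C}=E\times E$, with the product topology and $(x+iy)(u,v)=(xu-yv,\,xv+yu)$; identify $E$ with $E\times\{0\}$. A map between complex locally convex spaces, defined on an open set, is complex analytic if it is continuous and near each point $a$ of its domain equals pointwise a convergent series $\sum_{k\ge 0}p_k(x-a)$ of continuous homogeneous polynomials $p_k$ of degree $k$. A map $f\colon U\to F$ on an open set $U\subseteq E$, where $F$ is a real locally convex space, is real analytic if it extends to a complex analytic map $W\to F_{\mathbb C}$ on some open neighbourhood $W\subseteq E_{\mathbb C}$ of $U$. Real (resp. complex) analytic manifolds are defined by atlases with real (resp. complex) analytic chart changes. A complexification of a real analytic manifold $N$ modeled on $E$ is a complex analytic manifold $N^*$ modeled on $E_{\mathbb C}$ together with a topological embedding $\varphi\colon N\to N^*$ such that each point of $\varphi(N)$ lies in the domain $U^*$ of a chart $\psi\colon U^*\to U'\subseteq E_{\mathbb C}$ of $N^*$ which is adapted, that is, $\psi(\varphi(N)\cap U^*)=E\cap U'$ and $\psi\circ\varphi\colon\varphi^{-1}(U^*)\to E\cap U'$ is a chart of $N$. **Theorem.**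 Let $M$ be a real analytic manifold modeled on a real locally convex space $E$. Assume that, as topological spaces, $M$ is regular and $E_{\mathbb C}$ is normal. Then every compact subset $K\subseteq M$ has an open neighbourhood $\Omega\subseteq M$ that admits a complexification $(\Omega^*,\varphi)$ for which $\Omega^*$ is a regular Hausdorff topological space. Moreover, $\Omega^*$ can be chosen to be glued from finitely many open subsets of $E_{\mathbb C}$ along complex analytic extensions of chart changes: it has a finite atlas of adapted charts $\psi_1,\dots,\psi_n$ such that the domains of the charts $c_i=\psi_i\circ\varphi$ cover $\Omega$ and each $\psi_j\circ\psi_i^{-1}$ is a complex analytic extension of $c_j\circ c_i^{-1}$. -/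

import Mathlib

open Set Filter Topology
open scoped Manifold

universe u v

/-- The complexification `E_ℂ = E × E` of a real locally convex space `E`, with the product
topology; the pair `(u, v)` stands for `u + i v`. -/
def Cx (E : Type*) : Type _ := E × E

namespace Cx

section Algebra

variable {E : Type*}

/-- The real part `u` of `u + i v`. -/
def re (p : Cx E) : E := Prod.fst p

/-- The imaginary part `v` of `u + i v`. -/
def im (p : Cx E) : E := Prod.snd p

/-- The element `u + i v`. -/
def mk (u v : E) : Cx E := Prod.mk u v

theorem ext {p q : Cx E} (h₁ : p.re = q.re) (h₂ : p.im = q.im) : p = q := Prod.ext h₁ h₂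

instance [TopologicalSpace E] : TopologicalSpace (Cx E) :=
  inferInstanceAs (TopologicalSpace (E × E))

instance [AddCommGroup E] : AddCommGroup (Cx E) := inferInstanceAs (AddCommGroup (E × E))

/-- `(x + i y) • (u, v) = (x u - y v, x v + y u)`. -/
instance [AddCommGroup E] [Module ℝ E] : SMul ℂ (Cx E) :=
  ⟨fun z p => mk (z.re • p.re - z.im • p.im) (z.re • p.im + z.im • p.re)⟩

theorem add_re [AddCommGroup E] (p q : Cx E) : (p + q).re = p.re + q.re := rfl

theorem add_im [AddCommGroup E] (p q : Cx E) : (p + q).im = p.im + q.im := rfl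

theorem zero_re [AddCommGroup E] : (0 : Cx E).re = 0 := rfl

theorem zero_im [AddCommGroup E] : (0 : Cx E).im = 0 := rfl

theorem smul_re [AddCommGroup E] [Module ℝ E] (z : ℂ) (p : Cx E) :
    (z • p).re = z.re • p.re - z.im • p.im := rfl

theorem smul_im [AddCommGroup E] [Module ℝ E] (z : ℂ) (p : Cx E) :
    (z • p).im = z.re • p.im + z.im • p.re := rfl

instance [AddCommGroup E] [Module ℝ E] : Module ℂ (Cx E) where
  one_smul p := ext (by simp [smul_re]) (by simp [smul_im])
  mul_smul z w p := ext
    (by simp only [smul_re, smul_im, Complex.mul_re, Complex.mul_im]; module)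
    (by simp only [smul_re, smul_im, Complex.mul_re, Complex.mul_im]; module)
  smul_zero z := ext (by simp [smul_re, zero_re, zero_im]) (by simp [smul_im, zero_re, zero_im])
  smul_add z p q := ext
    (by simp only [smul_re, add_re, add_im]; module)
    (by simp only [smul_im, add_re, add_im]; module)
  add_smul z w p := ext
    (by simp only [smul_re, add_re, Complex.add_re, Complex.add_im]; module)
    (by simp only [smul_im, add_im, Complex.add_re, Complex.add_im]; module)
  zero_smul p := ext (by simp [smul_re, zero_re]) (by simp [smul_im, zero_im])

/-- The identification of `E` with the real subspace `E × {0}` of `E_ℂ`. -/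
def ofReal [AddCommGroup E] (x : E) : Cx E := mk x 0

end Algebra

end Cx

/-- Complex analyticity of `f` on an open set `U` of a complex locally convex space: `f` is
continuous and is, near each point of `U`, the pointwise limit of a series of continuous
homogeneous polynomials (the diagonals of continuous `k`-linear maps). -/
def ComplexAnalyticOn {F G : Type*} [AddCommGroup F] [Module ℂ F] [TopologicalSpace F]
    [AddCommGroup G] [Module ℂ G] [TopologicalSpace G] (f : F → G) (U : Set F) : Prop :=
  ContinuousOn f U ∧
    ∀ a ∈ U, ∃ p : ∀ k : ℕ, ContinuousMultilinearMap ℂ (fun _ : Fin k => F) G,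
      ∀ᶠ x in 𝓝 a,
        Tendsto (fun n : ℕ => ∑ k ∈ Finset.range n, p k (fun _ => x - a)) atTop (𝓝 (f x))

/-- Real analyticity of `f` on an open set `U` of a real locally convex space: `f` extends to a
complex analytic map on an open neighbourhood of `U` in the complexification. -/
def RealAnalyticOn {E F : Type*} [AddCommGroup E] [Module ℝ E] [TopologicalSpace E]
    [AddCommGroup F] [Module ℝ F] [TopologicalSpace F] (f : E → F) (U : Set E) : Prop :=
  ∃ (W : Set (Cx E)) (g : Cx E → Cx F), IsOpen W ∧ Cx.ofReal '' U ⊆ W ∧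
    ComplexAnalyticOn g W ∧ ∀ x ∈ U, g (Cx.ofReal x) = Cx.ofReal (f x)

section Real

variable (E : Type*) [AddCommGroup E] [Module ℝ E] [TopologicalSpace E]

/-- The charted space `M` is a (Hausdorff) real analytic manifold modeled on `E`. -/
structure IsRealAnalyticManifold (M : Type*) [TopologicalSpace M] [ChartedSpace E M] :
    Prop where
  t2 : T2Space M
  compatible : ∀ e ∈ atlas E M, ∀ e' ∈ atlas E M,
    RealAnalyticOn (e.symm ≫ₕ e') (e.symm ≫ₕ e').source

variable {E}

/-- `e` is a chart of the real analytic manifold `M`, i.e. belongs to its maximal atlas. -/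
def IsRealAnalyticChart {M : Type*} [TopologicalSpace M] [ChartedSpace E M]
    (e : OpenPartialHomeomorph M E) : Prop :=
  ∀ e' ∈ atlas E M, RealAnalyticOn (e.symm ≫ₕ e') (e.symm ≫ₕ e').source ∧
    RealAnalyticOn (e'.symm ≫ₕ e) (e'.symm ≫ₕ e).source

end Real

section Complex

variable (F : Type*) [AddCommGroup F] [Module ℂ F] [TopologicalSpace F]

/-- The charted space `X` is a (Hausdorff) complex analytic manifold modeled on `F`. -/
structure IsComplexAnalyticManifold (X : Type*) [TopologicalSpace X] [ChartedSpace F X] :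
    Prop where
  t2 : T2Space X
  compatible : ∀ e ∈ atlas F X, ∀ e' ∈ atlas F X,
    ComplexAnalyticOn (e.symm ≫ₕ e') (e.symm ≫ₕ e').source

variable {F}

/-- `e` is a chart of the complex analytic manifold `X`, i.e. belongs to its maximal atlas. -/
def IsComplexAnalyticChart {X : Type*} [TopologicalSpace X] [ChartedSpace F X]
    (e : OpenPartialHomeomorph X F) : Prop :=
  ∀ e' ∈ atlas F X, ComplexAnalyticOn (e.symm ≫ₕ e') (e.symm ≫ₕ e').source ∧
    ComplexAnalyticOn (e'.symm ≫ₕ e) (e'.symm ≫ₕ e).source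

end Complex

section Complexification

variable {E : Type*} [AddCommGroup E] [Module ℝ E] [TopologicalSpace E]
  {M : Type*} [TopologicalSpace M] [ChartedSpace E M]
  {X : Type*} [TopologicalSpace X] [ChartedSpace (Cx E) X]

/-- With `M` viewed as a subset of `X` through `φ`: the chart `ψ : U* → U'` of `X` satisfies
`ψ (M ∩ U*) = E ∩ U'`, and its restriction `M ∩ U* → E ∩ U'` is the chart `c` of `M`. -/
structure RestrictsToChart (φ : M → X) (ψ : OpenPartialHomeomorph X (Cx E))
    (c : OpenPartialHomeomorph M E) : Prop where
  complexChart : IsComplexAnalyticChart ψ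
  realChart : IsRealAnalyticChart c
  image_eq : ψ '' (range φ ∩ ψ.source) = range Cx.ofReal ∩ ψ.target
  source_eq : c.source = φ ⁻¹' ψ.source
  eq_on : ∀ y ∈ c.source, ψ (φ y) = Cx.ofReal (c y)

/-- `X`, with the embedding `φ : M → X`, is a complexification of the real analytic manifold
`M` modeled on `E`. -/
structure IsComplexification (φ : M → X) : Prop where
  manifold : IsComplexAnalyticManifold (Cx E) X
  isEmbedding : IsEmbedding φ
  exists_chart : ∀ x : M, ∃ (ψ : OpenPartialHomeomorph X (Cx E))
    (c : OpenPartialHomeomorph M E), φ x ∈ ψ.source ∧ RestrictsToChart φ ψ c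

/-- The complexification `X` of `M` is glued from finitely many open subsets `ψᵢ.target` of
`E_ℂ`: the `ψᵢ` form an atlas of `X`, and the gluing maps `ψⱼ ∘ ψᵢ⁻¹` are complex analytic
extensions of the changes `cⱼ ∘ cᵢ⁻¹` between charts `cᵢ` of `M` whose domains cover `M`. -/
def IsFinitelyGlued (φ : M → X) : Prop :=
  ∃ (n : ℕ) (ψ : Fin n → OpenPartialHomeomorph X (Cx E))
    (c : Fin n → OpenPartialHomeomorph M E),
    atlas (Cx E) X = range ψ ∧
    (∀ i, RestrictsToChart φ (ψ i) (c i)) ∧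
    (⋃ i, (ψ i).source) = univ ∧ (⋃ i, (c i).source) = univ ∧
    ∀ i j,
      ComplexAnalyticOn ((ψ i).symm ≫ₕ ψ j) ((ψ i).symm ≫ₕ ψ j).source ∧
      ∀ x ∈ ((c i).symm ≫ₕ c j).source,
        Cx.ofReal x ∈ ((ψ i).symm ≫ₕ ψ j).source ∧
        ((ψ i).symm ≫ₕ ψ j) (Cx.ofReal x) = Cx.ofReal (((c i).symm ≫ₕ c j) x)

end Complexification

/-! Finitely many charts `c i` cover `K`. Regularity of `M` and `E` provides closed sets `B i`
inside the chart domains whose interiors `N i` cover `K` and whose images under `c i` are closed in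
`E`, so that `D i`, the image of `B i` in `E_ℂ`, is closed. The chart changes extend to mutually
inverse complex analytic maps `h i j` between open subsets of `E_ℂ`. It remains to find open `V i ⊇
D i` that glue along these maps. There are two obstacles: the cocycle identity is known only near
real points, and such a quotient may fail to be Hausdorff.

The identity theorem `HolomorphicAlongLines.eventuallyEq_of_eq_ofReal` gives the cocycle identity
near real points: `x + iy` lies on the complex line `t ↦ x + ty`, whose real parameters give real
points, so the one-variable theorem and Hahn-Banach suffice. It asks only for holomorphy along lines
after applying a functional. For composites this follows from second-order estimates on pointwise
convergent series, see `differentiableAt_comp_of_tendsto`.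

The gluing, `IsTransitionFamily.exists_isGluable`, rests on normality of `E_ℂ`. After shrinking the
domains of the `h i j`, the bad points for `(i, j, k)`, where `h j k ∘ h i j` is defined but the
cocycle identity is not secured, form a closed set. No bad point has itself and its two images in `D
i`, `D j`, `D k`. Normality preserves this for neighbourhoods of the `D i`, and there are finitely
many triples. The degenerate triples `(i, j, j)` keep the closure of each overlap, relative to `V
i`, inside the domain of `h i j`. This makes the quotient regular; being T1, it is then Hausdorff.
-/

/-! ### Estimates for pointwise convergent power series -/

section PowerSeries

variable {F : Type*} [AddCommGroup F] [Module ℂ F] [TopologicalSpace F]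

/-- The remainder after the linear term of a series `∑ sᵏ aₖ` with bounded coefficients. -/
theorem Seminorm.sub_linear_part_le {p : Seminorm ℂ F} (hp : Continuous p)
    [IsTopologicalAddGroup F] {a : ℕ → F} {B : ℝ} (hB : ∀ k, p (a k) ≤ B) {s : ℂ}
    (hs : ‖s‖ ≤ 1 / 2) {y : F}
    (hy : Tendsto (fun n : ℕ => ∑ k ∈ Finset.range n, s ^ k • a k) atTop (𝓝 y)) :
    p (y - a 0 - s • a 1) ≤ 2 * B * ‖s‖ ^ 2 := by
  have hB0 : 0 ≤ B := (apply_nonneg p _).trans (hB 0)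
  have key : ∀ n : ℕ, p ((∑ k ∈ Finset.range (n + 2), s ^ k • a k) - a 0 - s • a 1) ≤
      2 * B * ‖s‖ ^ 2 := by
    intro n
    have h1 : (∑ k ∈ Finset.range (n + 2), s ^ k • a k) - a 0 - s • a 1 =
        ∑ k ∈ Finset.range n, s ^ (k + 2) • a (k + 2) := by
      rw [Finset.sum_range_succ', Finset.sum_range_succ']
      simp only [zero_add, pow_one, pow_zero, one_smul]
      abel
    rw [h1]
    calc p (∑ k ∈ Finset.range n, s ^ (k + 2) • a (k + 2))
        ≤ ∑ k ∈ Finset.range n, p (s ^ (k + 2) • a (k + 2)) :=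
          Finset.le_sum_of_subadditive p (map_zero p).le (map_add_le_add p) _ _
      _ ≤ ∑ k ∈ Finset.range n, (1 / 2 : ℝ) ^ k * (B * ‖s‖ ^ 2) := by
          refine Finset.sum_le_sum fun k _ => ?_
          rw [map_smul_eq_mul, norm_pow, pow_add]
          have h2 : ‖s‖ ^ k ≤ (1 / 2 : ℝ) ^ k := pow_le_pow_left₀ (norm_nonneg _) hs k
          calc ‖s‖ ^ k * ‖s‖ ^ 2 * p (a (k + 2)) ≤ ‖s‖ ^ k * ‖s‖ ^ 2 * B := by
                gcongr; exact hB _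
            _ ≤ (1 / 2 : ℝ) ^ k * ‖s‖ ^ 2 * B := by gcongr
            _ = _ := by ring
      _ = (∑ k ∈ Finset.range n, (1 / 2 : ℝ) ^ k) * (B * ‖s‖ ^ 2) := by rw [Finset.sum_mul]
      _ ≤ 2 * (B * ‖s‖ ^ 2) := by
          gcongr
          exact sum_geometric_two_le n
      _ = _ := by ring
  have hlim : Tendsto (fun n : ℕ => p ((∑ k ∈ Finset.range (n + 2), s ^ k • a k) - a 0 - s • a 1))
      atTop (𝓝 (p (y - a 0 - s • a 1))) := by
    refine (hp.tendsto _).comp ?_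
    exact ((hy.comp (tendsto_add_atTop_nat 2)).sub_const _).sub_const _
  exact le_of_tendsto' hlim key

/-- The terms of a convergent series are bounded for every continuous seminorm. -/
theorem Seminorm.exists_bound_of_tendsto_sum {p : Seminorm ℂ F} (hp : Continuous p)
    [IsTopologicalAddGroup F] {a : ℕ → F} {y : F}
    (hy : Tendsto (fun n : ℕ => ∑ k ∈ Finset.range n, a k) atTop (𝓝 y)) :
    ∃ B, ∀ k, p (a k) ≤ B := by
  have h : Tendsto a atTop (𝓝 0) := by
    have := (hy.comp (tendsto_add_atTop_nat 1)).sub hy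
    simpa [Function.comp_def, Finset.sum_range_succ] using this
  have h2 : Tendsto (fun k => p (a k)) atTop (𝓝 0) := by
    simpa [Function.comp_def] using (hp.tendsto 0).comp h
  obtain ⟨B, hB⟩ := h2.bddAbove_range
  exact ⟨B, fun k => hB ⟨k, rfl⟩⟩

/-- A curve given by a pointwise convergent power series is differentiable to second order,
measured in a continuous seminorm. -/
theorem exists_sub_linear_part_le_of_tendsto {p : Seminorm ℂ F} (hp : Continuous p)
    [IsTopologicalAddGroup F] {γ : ℂ → F} {t₀ : ℂ} {q : ℕ → F}
    (hγ : ∀ᶠ t in 𝓝 t₀,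
      Tendsto (fun n : ℕ => ∑ k ∈ Finset.range n, (t - t₀) ^ k • q k) atTop (𝓝 (γ t))) :
    ∃ R, 0 ≤ R ∧ ∀ᶠ t in 𝓝 t₀, p (γ t - q 0 - (t - t₀) • q 1) ≤ R * ‖t - t₀‖ ^ 2 := by
  obtain ⟨ε, hε, hball⟩ := Metric.eventually_nhds_iff.1 hγ
  -- Convergence at the single point `t₀ + ε/2` bounds the rescaled coefficients `(ε/2)ᵏ • q k`; for
  -- `‖t - t₀‖ < ε/4` the ratio to `ε/2` is at most `1/2`.
  have hr : (0 : ℝ) < ε / 2 := by positivity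
  have hrne : ((ε / 2 : ℝ) : ℂ) ≠ 0 := by exact_mod_cast hr.ne'
  obtain ⟨B, hB⟩ := Seminorm.exists_bound_of_tendsto_sum hp
    (hball (y := t₀ + ((ε / 2 : ℝ) : ℂ)) (by
      rw [dist_eq_norm, add_sub_cancel_left, Complex.norm_real, Real.norm_of_nonneg hr.le]
      linarith))
  simp only [add_sub_cancel_left] at hB
  have hB0 : 0 ≤ B := (apply_nonneg p _).trans (hB 0)
  refine ⟨2 * B / (ε / 2) ^ 2, by positivity, ?_⟩
  filter_upwards [hγ, Metric.ball_mem_nhds t₀ (show (0 : ℝ) < ε / 4 by positivity)] with t ht htb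
  rw [mem_ball_iff_norm] at htb
  have hnorm : ‖(t - t₀) / ((ε / 2 : ℝ) : ℂ)‖ = ‖t - t₀‖ / (ε / 2) := by
    rw [norm_div, Complex.norm_real, Real.norm_of_nonneg hr.le]
  have := Seminorm.sub_linear_part_le hp hB (s := (t - t₀) / ((ε / 2 : ℝ) : ℂ)) (y := γ t)
    (by rw [hnorm, div_le_iff₀ hr]; linarith)
    (by
      refine ht.congr fun n => Finset.sum_congr rfl fun k _ => ?_
      rw [smul_smul, div_pow, div_mul_cancel₀ _ (pow_ne_zero _ hrne)])
  rw [hnorm, pow_zero, one_smul, pow_one, smul_smul, div_mul_cancel₀ _ hrne] at this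
  refine this.trans (le_of_eq ?_)
  rw [div_pow]; ring

/-- Cauchy's estimate for a power series converging pointwise on the closed unit disc. -/
theorem norm_coeff_le_of_tendsto {a : ℕ → ℂ} {f : ℂ → ℂ} {C : ℝ}
    (hf : ∀ s : ℂ, ‖s‖ ≤ 1 →
      Tendsto (fun n : ℕ => ∑ k ∈ Finset.range n, s ^ k * a k) atTop (𝓝 (f s)))
    (hC : ∀ s : ℂ, ‖s‖ ≤ 1 → ‖f s‖ ≤ C) (n : ℕ) : ‖a n‖ ≤ C := by
  obtain ⟨B, hB⟩ : ∃ B, ∀ k, ‖a k‖ ≤ B := by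
    have := hf 1 (by simp)
    simp only [one_pow, one_mul] at this
    exact Seminorm.exists_bound_of_tendsto_sum (p := normSeminorm ℂ ℂ) continuous_norm this
  set P := FormalMultilinearSeries.ofScalars ℂ a with hP
  have hrad : (1 : ENNReal) ≤ P.radius := by
    refine P.le_radius_of_bound (r := 1) B fun k => ?_
    simpa [hP] using hB k
  have hsum : ∀ s : ℂ, ‖s‖ < 1 → P.sum s = f s := by
    intro s hs
    have hsum : HasSum (fun k => P k fun _ => s) (P.sum s) := by
      refine P.hasSum ?_
      simp only [Metric.mem_eball, edist_zero_right]
      refine lt_of_lt_of_le ?_ hrad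
      rw [enorm_eq_nnnorm]
      exact_mod_cast (by simpa [← NNReal.coe_lt_coe] using hs : ‖s‖₊ < 1)
    refine tendsto_nhds_unique hsum.tendsto_sum_nat ((hf s hs.le).congr fun n => ?_)
    refine Finset.sum_congr rfl fun k _ => ?_
    simp [hP, mul_comm]
  have hps : HasFPowerSeriesOnBall f P 0 1 :=
    ((P.hasFPowerSeriesOnBall (lt_of_lt_of_le one_pos hrad)).mono one_pos hrad).congr
      fun s hs => hsum s (by
        simpa [Metric.mem_eball, edist_zero_right, enorm_eq_nnnorm, ← NNReal.coe_lt_coe] using hs)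
  have hder : iteratedDeriv n f 0 = n.factorial * a n := by
    have := hps.factorial_smul 1 n
    rw [iteratedDeriv_eq_iteratedFDeriv, ← this]
    simp [hP]
  -- The series is known to be holomorphic only on the open disc, so Cauchy's estimate is taken on
  -- circles of radius `r < 1`, and then `r → 1`.
  have hest : ∀ r : ℝ, 0 < r → r < 1 → ‖a n‖ * r ^ n ≤ C := by
    intro r hr0 hr1
    have hd : DiffContOnCl ℂ f (Metric.ball 0 r) := by
      refine DifferentiableOn.diffContOnCl_ball (U := Metric.ball 0 1) ?_ ?_
      · have := hps.differentiableOn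
        refine this.mono fun s hs => ?_
        simpa [Metric.mem_eball, edist_zero_right, enorm_eq_nnnorm, ← NNReal.coe_lt_coe] using hs
      · exact Metric.closedBall_subset_ball hr1
    have h := Complex.norm_iteratedDeriv_le_of_forall_mem_sphere_norm_le n hr0 hd (C := C)
      fun z hz => hC z (by rw [mem_sphere_zero_iff_norm.1 hz]; exact hr1.le)
    rw [hder, norm_mul, Complex.norm_natCast, mul_div_assoc] at h
    have h' := le_of_mul_le_mul_left h (by exact_mod_cast n.factorial_pos)
    rwa [le_div_iff₀ (by positivity)] at h'
  have hlim : Tendsto (fun r : ℝ => ‖a n‖ * r ^ n) (𝓝[<] 1) (𝓝 (‖a n‖ * 1 ^ n)) :=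
    (Continuous.tendsto (by fun_prop) 1).mono_left nhdsWithin_le_nhds
  rw [one_pow, mul_one] at hlim
  refine le_of_tendsto hlim ?_
  filter_upwards [Ioo_mem_nhdsLT (show (0 : ℝ) < 1 by norm_num)] with r hr
  exact hest r hr.1 hr.2

end PowerSeries

/-! ### Differentiability of a scalar analytic function along a curve -/

section Composition

variable {F : Type*} [AddCommGroup F] [Module ℂ F] [TopologicalSpace F]
  [IsTopologicalAddGroup F]

theorem exists_continuous_seminorm_ball_subset [PolynormableSpace ℂ F] {V : Set F}
    (hV : V ∈ 𝓝 (0 : F)) : ∃ p : Seminorm ℂ F, Continuous p ∧ {v | p v < 1} ⊆ V := by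
  have hw := PolynormableSpace.withSeminorms (𝕜 := ℂ) (E := F)
  obtain ⟨s, r, hr, hs⟩ := (hw.mem_nhds_iff 0 V).1 hV
  let q : Seminorm ℂ F := s.sup fun p : {p : Seminorm ℂ F // Continuous p} => p.1
  have hq : Continuous q := Seminorm.continuous_finsetSup fun i _ => i.2
  let c : NNReal := ⟨r⁻¹, by positivity⟩
  refine ⟨c • q, hq.const_smul c, fun v hv => hs ?_⟩
  rw [Seminorm.mem_ball_zero]
  have : r⁻¹ * q v < 1 := hv
  rwa [inv_mul_lt_iff₀ hr, mul_one] at this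

/-- A continuous scalar function with a pointwise convergent expansion into homogeneous
polynomials is differentiable to second order, measured in a continuous seminorm. -/
theorem exists_seminorm_sub_linear_part_le [PolynormableSpace ℂ F] {g : F → ℂ} {b : F}
    (hg : ContinuousAt g b) {P : ∀ k : ℕ, ContinuousMultilinearMap ℂ (fun _ : Fin k => F) ℂ}
    (hP : ∀ᶠ x in 𝓝 b,
      Tendsto (fun n : ℕ => ∑ k ∈ Finset.range n, P k (fun _ => x - b)) atTop (𝓝 (g x))) :
    ∃ (p : Seminorm ℂ F) (C : ℝ), Continuous p ∧ ∀ (v : F) (s : ℝ), 0 < s → s ≤ 1 / 2 → p v < s →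
      ‖g (b + v) - P 0 (fun _ => 0) - P 1 (fun _ => v)‖ ≤ C * s ^ 2 := by
  have hbd : ∀ᶠ x in 𝓝 b, ‖g x‖ ≤ ‖g b‖ + 1 :=
    (hg.norm.eventually_lt_const (lt_add_one _)).mono fun _ h => h.le
  have htr : Tendsto (fun v : F => b + v) (𝓝 0) (𝓝 b) := by
    simpa using (continuous_const_add b).tendsto (0 : F)
  obtain ⟨p, hp, hpV⟩ := exists_continuous_seminorm_ball_subset (htr.eventually (hbd.and hP))
  refine ⟨p, 2 * (‖g b‖ + 1), hp, fun v s hs0 hs hv => ?_⟩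
  have hsne : (s : ℂ) ≠ 0 := by exact_mod_cast hs0.ne'
  have hpw : p ((s : ℂ)⁻¹ • v) < 1 := by
    rw [map_smul_eq_mul, norm_inv, Complex.norm_real, Real.norm_of_nonneg hs0.le,
      inv_mul_lt_iff₀ hs0, mul_one]
    exact hv
  -- The disc `b + z • w`, `‖z‖ ≤ 1`, stays where `g` is bounded by `‖g b‖ + 1`. Cauchy's estimate
  -- thus bounds all `P k (w, …, w)` by a constant independent of `v` and `s`; evaluating at `z = s`
  -- yields the factor `s ^ 2`.
  set w := (s : ℂ)⁻¹ • v with hw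
  have hvw : v = (s : ℂ) • w := by rw [hw, smul_inv_smul₀ hsne]
  have hin : ∀ z : ℂ, ‖z‖ ≤ 1 → p (z • w) < 1 := by
    intro z hz
    rw [map_smul_eq_mul]
    exact (mul_le_of_le_one_left (apply_nonneg _ _) hz).trans_lt hpw
  have hhom : ∀ (z : ℂ) (k : ℕ), P k (fun _ => z • w) = z ^ k * P k (fun _ => w) := by
    intro z k
    have := (P k).map_smul_univ (fun _ => z) (fun _ => w)
    simpa using this
  have hser : ∀ z : ℂ, ‖z‖ ≤ 1 →
      Tendsto (fun n : ℕ => ∑ k ∈ Finset.range n, z ^ k * P k (fun _ => w)) atTop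
        (𝓝 (g (b + z • w))) := by
    intro z hz
    refine (hpV (hin z hz)).2.congr fun n => Finset.sum_congr rfl fun k _ => ?_
    rw [add_sub_cancel_left, hhom]
  have hcoef := norm_coeff_le_of_tendsto hser fun z hz => (hpV (hin z hz)).1
  have := Seminorm.sub_linear_part_le (p := normSeminorm ℂ ℂ) continuous_norm hcoef
    (s := (s : ℂ)) (by rwa [Complex.norm_real, Real.norm_of_nonneg hs0.le])
    (hser s (by rw [Complex.norm_real, Real.norm_of_nonneg hs0.le]; linarith))
  rw [Complex.norm_real, Real.norm_of_nonneg hs0.le] at this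
  rw [hvw]
  have h0 : (fun _ : Fin 0 => (0 : F)) = fun _ => w := funext fun i => i.elim0
  rw [h0, hhom, pow_one]
  exact this

/-- The composite of a curve given by a power series with a scalar analytic function is complex
differentiable. -/
theorem differentiableAt_comp_of_tendsto [PolynormableSpace ℂ F] {g : F → ℂ} {γ : ℂ → F} {t₀ : ℂ}
    (hg : ContinuousAt g (γ t₀))
    {P : ∀ k : ℕ, ContinuousMultilinearMap ℂ (fun _ : Fin k => F) ℂ}
    (hP : ∀ᶠ x in 𝓝 (γ t₀),
      Tendsto (fun n : ℕ => ∑ k ∈ Finset.range n, P k (fun _ => x - γ t₀)) atTop (𝓝 (g x)))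
    {q : ℕ → F} (hq : q 0 = γ t₀)
    (hγ : ∀ᶠ t in 𝓝 t₀,
      Tendsto (fun n : ℕ => ∑ k ∈ Finset.range n, (t - t₀) ^ k • q k) atTop (𝓝 (γ t))) :
    DifferentiableAt ℂ (fun t => g (γ t)) t₀ := by
  obtain ⟨p, C, hp, hC⟩ := exists_seminorm_sub_linear_part_le hg hP
  obtain ⟨R, hR, hRγ⟩ := exists_sub_linear_part_le_of_tendsto hp hγ
  let ℓ : F →ₗ[ℂ] ℂ :=
    { toFun := fun v => P 1 (fun _ => v)
      map_add' := fun x y => by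
        have := (P 1).map_update_add (fun _ => x) 0 x y
        have h : ∀ z, Function.update (fun _ : Fin 1 => x) 0 z = fun _ => z := fun z => by
          funext i; rw [Subsingleton.elim i 0, Function.update_self]
        simpa only [h] using this
      map_smul' := fun c x => by
        have := (P 1).map_smul_univ (fun _ => c) (fun _ => x)
        simpa using this }
  have hℓ : Continuous ℓ := (P 1).cont.comp (continuous_pi fun _ => continuous_id)
  -- The remainder of `γ` is measured a second time in the seminorm `‖ℓ ·‖`, which avoids comparing
  -- `ℓ` with `p`.
  obtain ⟨S, hS, hSγ⟩ := exists_sub_linear_part_le_of_tendsto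
    (p := (normSeminorm ℂ ℂ).comp ℓ) (continuous_norm.comp hℓ) hγ
  have hP0 : g (γ t₀) = P 0 (fun _ => 0) := by
    refine tendsto_nhds_unique hP.self_of_nhds (tendsto_const_nhds.congr' ?_)
    filter_upwards [eventually_ge_atTop 1] with n hn
    rw [Finset.sum_eq_single_of_mem 0 (Finset.mem_range.2 hn)]
    · congr 1; funext i; exact i.elim0
    · intro k _ hk
      rw [sub_self]
      exact (P k).map_coord_zero (⟨0, Nat.pos_of_ne_zero hk⟩ : Fin k) rfl
  -- For `‖t - t₀‖ < 1` the linear term and the remainder give `p (γ t - γ t₀) ≤ (p (q 1) + R) ‖t -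
  -- t₀‖`; the summand `1` makes the bound strict. The radius `1 / (2 * A)` ensures `A * ‖t - t₀‖ ≤
  -- 1 / 2`.
  set A : ℝ := p (q 1) + R + 1 with hA
  have hA0 : 0 < A := by have := apply_nonneg p (q 1); positivity
  have hnear : ∀ᶠ t in 𝓝 t₀, ‖t - t₀‖ < min 1 (1 / (2 * A)) := by
    have : Tendsto (fun t => ‖t - t₀‖) (𝓝 t₀) (𝓝 0) := by
      have : Continuous fun t : ℂ => ‖t - t₀‖ := by fun_prop
      simpa using this.tendsto t₀
    exact this.eventually_lt_const (by positivity)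
  have hmain : ∀ᶠ t in 𝓝 t₀, ‖g (γ t) - g (γ t₀) - (t - t₀) * ℓ (q 1)‖ ≤
      (C * A ^ 2 + S) * ‖(t - t₀) ^ 2‖ := by
    filter_upwards [hRγ, hSγ, hnear] with t h1 h2 h3
    rcases eq_or_ne t t₀ with rfl | hne
    · simp
    have hpos : 0 < ‖t - t₀‖ := norm_pos_iff.2 (sub_ne_zero.2 hne)
    have h31 := h3.trans_le (min_le_left _ _)
    have h32 := h3.trans_le (min_le_right _ _)
    have hv : p (γ t - γ t₀) < A * ‖t - t₀‖ := by
      have e : γ t - γ t₀ = (γ t - q 0 - (t - t₀) • q 1) + (t - t₀) • q 1 := by rw [hq]; abel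
      rw [e]
      refine (map_add_le_add p _ _).trans_lt ?_
      rw [map_smul_eq_mul]
      have : R * ‖t - t₀‖ ^ 2 ≤ R * ‖t - t₀‖ := by
        gcongr; nlinarith
      rw [hA]
      nlinarith
    have h4 := hC (γ t - γ t₀) (A * ‖t - t₀‖) (by positivity)
      (by rw [lt_div_iff₀ (by positivity)] at h32; linarith) hv
    rw [add_sub_cancel, ← hP0] at h4
    have h5 : ‖ℓ (γ t - γ t₀) - (t - t₀) * ℓ (q 1)‖ ≤ S * ‖t - t₀‖ ^ 2 := by
      have : ‖ℓ (γ t - q 0 - (t - t₀) • q 1)‖ ≤ S * ‖t - t₀‖ ^ 2 := h2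
      rwa [map_sub, map_smul, hq, smul_eq_mul] at this
    calc ‖g (γ t) - g (γ t₀) - (t - t₀) * ℓ (q 1)‖
        = ‖(g (γ t) - g (γ t₀) - ℓ (γ t - γ t₀)) + (ℓ (γ t - γ t₀) - (t - t₀) * ℓ (q 1))‖ := by
          congr 1; ring
      _ ≤ C * (A * ‖t - t₀‖) ^ 2 + S * ‖t - t₀‖ ^ 2 := (norm_add_le _ _).trans (add_le_add h4 h5)
      _ = _ := by rw [norm_pow]; ring
  have hO : (fun t => g (γ t) - g (γ t₀) - (t - t₀) * ℓ (q 1)) =O[𝓝 t₀] fun t => (t - t₀) ^ 2 :=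
    Asymptotics.IsBigO.of_bound _ hmain
  have : HasDerivAt (fun t => g (γ t)) (ℓ (q 1)) t₀ := by
    rw [hasDerivAt_iff_isLittleO]
    refine hO.trans_isLittleO ?_
    have h0 : Tendsto (fun t : ℂ => t - t₀) (𝓝 t₀) (𝓝 0) := by
      have : Continuous fun t : ℂ => t - t₀ := by fun_prop
      simpa using this.tendsto t₀
    exact (Asymptotics.isLittleO_pow_id (one_lt_two)).comp_tendsto h0
  exact this.differentiableAt

end Composition

/-! ### Topology and duality of the complexification -/

namespace Cx

variable {E : Type*}

theorem continuous_re [TopologicalSpace E] : Continuous (re : Cx E → E) := continuous_fst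

theorem continuous_im [TopologicalSpace E] : Continuous (im : Cx E → E) := continuous_snd

theorem continuous_mk [TopologicalSpace E] {A : Type*} [TopologicalSpace A] {f g : A → E}
    (hf : Continuous f) (hg : Continuous g) : Continuous fun a => mk (f a) (g a) :=
  Continuous.prodMk hf hg

theorem re_ofReal [AddCommGroup E] (x : E) : (ofReal x).re = x := rfl

theorem im_ofReal [AddCommGroup E] (x : E) : (ofReal x).im = 0 := rfl

theorem ofReal_injective [AddCommGroup E] : Function.Injective (ofReal : E → Cx E) :=
  Function.LeftInverse.injective re_ofReal

instance [TopologicalSpace E] [T2Space E] : T2Space (Cx E) := inferInstanceAs (T2Space (E × E))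

variable [AddCommGroup E] [TopologicalSpace E]

theorem continuous_ofReal : Continuous (ofReal : E → Cx E) :=
  continuous_mk continuous_id continuous_const

theorem isClosedEmbedding_ofReal [T2Space E] : IsClosedEmbedding (ofReal : E → Cx E) := by
  refine .of_continuous_injective_isClosedMap continuous_ofReal ofReal_injective fun s hs => ?_
  have : ofReal '' s = {z : Cx E | z.re ∈ s} ∩ {z | z.im = 0} := by
    ext z
    constructor
    · rintro ⟨x, hx, rfl⟩
      exact ⟨hx, rfl⟩
    · rintro ⟨h1, h2⟩
      exact ⟨z.re, h1, Cx.ext rfl h2.symm⟩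
  rw [this]
  exact (hs.preimage continuous_re).inter (isClosed_singleton.preimage continuous_im)

instance [IsTopologicalAddGroup E] : IsTopologicalAddGroup (Cx E) :=
  inferInstanceAs (IsTopologicalAddGroup (E × E))

variable [Module ℝ E]

instance [IsTopologicalAddGroup E] [ContinuousSMul ℝ E] : ContinuousSMul ℂ (Cx E) where
  continuous_smul := by
    have h1 := (continuous_re (E := E)).comp (continuous_snd (X := ℂ))
    have h2 := (continuous_im (E := E)).comp (continuous_snd (X := ℂ))
    have h3 := Complex.continuous_re.comp (continuous_fst (Y := Cx E))
    have h4 := Complex.continuous_im.comp (continuous_fst (Y := Cx E))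
    exact continuous_mk ((h3.smul h1).sub (h4.smul h2)) ((h3.smul h2).add (h4.smul h1))

-- A nonnegative element of `ℂ` is real, so convexity over `ℂ` reduces to real convexity in each
-- component.
open scoped ComplexOrder in
instance [IsTopologicalAddGroup E] [LocallyConvexSpace ℝ E] : LocallyConvexSpace ℂ (Cx E) := by
  have hb := (LocallyConvexSpace.convex_basis_zero ℝ E).prod_nhds
    (LocallyConvexSpace.convex_basis_zero ℝ E)
  refine LocallyConvexSpace.ofBasisZero ℂ (Cx E) _ _ hb ?_
  rintro ⟨s, t⟩ ⟨⟨-, hs⟩, -, ht⟩ x hx y hy a b ha hb hab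
  obtain ⟨ha, ha'⟩ := Complex.nonneg_iff.1 ha
  obtain ⟨hb, hb'⟩ := Complex.nonneg_iff.1 hb
  have hab' : a.re + b.re = 1 := by simpa using congrArg Complex.re hab
  constructor
  · have := hs hx.1 hy.1 ha hb hab'
    change (a • x + b • y).re ∈ s
    rw [add_re, smul_re, smul_re, ← ha', ← hb']
    rw [zero_smul, zero_smul, sub_zero, sub_zero]
    exact this
  · have := ht hx.2 hy.2 ha hb hab'
    change (a • x + b • y).im ∈ t
    rw [add_im, smul_im, smul_im, ← ha', ← hb']
    rw [zero_smul, zero_smul, add_zero, add_zero]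
    exact this

instance [IsTopologicalAddGroup E] [ContinuousSMul ℝ E] [LocallyConvexSpace ℝ E] :
    PolynormableSpace ℂ (Cx E) := by
  have : ContinuousSMul ℝ (Cx E) := IsScalarTower.continuousSMul (M := ℝ) ℂ
  infer_instance

/-- The complex linear extension of a real continuous linear functional. -/
noncomputable def extendDual (l : E →L[ℝ] ℝ) : Cx E →L[ℂ] ℂ where
  toFun z := ⟨l z.re, l z.im⟩
  map_add' z w := Complex.ext (by simp [add_re]) (by simp [add_im])
  map_smul' c z := Complex.ext (by simp [smul_re]) (by simp [smul_im])
  cont := by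
    have : Continuous fun z : Cx E => Complex.equivRealProdCLM.symm (l z.re, l z.im) :=
      Complex.equivRealProdCLM.symm.continuous.comp
        ((l.continuous.comp continuous_re).prodMk (l.continuous.comp continuous_im))
    exact this.congr fun z => Complex.ext (by simp) (by simp)

theorem eq_of_forall_dual_eq [IsTopologicalAddGroup E] [ContinuousSMul ℝ E]
    [LocallyConvexSpace ℝ E] [T2Space E] {z w : Cx E} (h : ∀ l : Cx E →L[ℂ] ℂ, l z = l w) :
    z = w := by
  refine Cx.ext ?_ ?_
  · exact (SeparatingDual.eq_iff_forall_dual_eq (R := ℝ)).2 fun l =>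
      congrArg Complex.re (h (extendDual l))
  · exact (SeparatingDual.eq_iff_forall_dual_eq (R := ℝ)).2 fun l =>
      congrArg Complex.im (h (extendDual l))

end Cx

/-! ### Holomorphy along complex lines -/

section Analytic

variable {F G : Type*} [AddCommGroup F] [Module ℂ F] [AddCommGroup G] [Module ℂ G]
  [TopologicalSpace G]

/-- `f` is weakly holomorphic along every complex affine line, at the points of `W`. -/
def HolomorphicAlongLines (f : F → G) (W : Set F) : Prop :=
  ∀ (l : G →L[ℂ] ℂ) (a b : F) (t : ℂ), a + t • b ∈ W →
    DifferentiableAt ℂ (fun t => l (f (a + t • b))) t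

theorem HolomorphicAlongLines.mono {f : F → G} {V W : Set F} (hf : HolomorphicAlongLines f W)
    (h : V ⊆ W) : HolomorphicAlongLines f V :=
  fun l a b t ht => hf l a b t (h ht)

variable [TopologicalSpace F]

theorem ComplexAnalyticOn.mono_congr {f f' : F → G} {U V : Set F} (hf : ComplexAnalyticOn f U)
    (hV : IsOpen V) (hVU : V ⊆ U) (h : ∀ x ∈ V, f' x = f x) : ComplexAnalyticOn f' V := by
  refine ⟨(hf.1.mono hVU).congr h, fun a ha => ?_⟩
  obtain ⟨p, hp⟩ := hf.2 a (hVU ha)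
  refine ⟨p, ?_⟩
  filter_upwards [hp, hV.mem_nhds ha] with x hx hxV
  rwa [h x hxV]

theorem holomorphicAlongLines_id (W : Set F) : HolomorphicAlongLines (fun x : F => x) W := by
  intro l a b t _
  simp only [map_add, map_smul]
  fun_prop

theorem ComplexAnalyticOn.exists_scalar_series {g : F → G} {V : Set F} (hg : ComplexAnalyticOn g V)
    {b : F} (hb : b ∈ V) (l : G →L[ℂ] ℂ) :
    ∃ P : ∀ k : ℕ, ContinuousMultilinearMap ℂ (fun _ : Fin k => F) ℂ, ∀ᶠ x in 𝓝 b,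
      Tendsto (fun n : ℕ => ∑ k ∈ Finset.range n, P k (fun _ => x - b)) atTop
        (𝓝 (l (g x))) := by
  obtain ⟨p, hp⟩ := hg.2 b hb
  refine ⟨fun k => l.compContinuousMultilinearMap (p k), hp.mono fun x hx => ?_⟩
  refine ((l.continuous.tendsto _).comp hx).congr fun n => ?_
  simp

variable [IsTopologicalAddGroup F]

theorem tendsto_line [ContinuousSMul ℂ F] (a b : F) (t₀ : ℂ) : Tendsto (fun t : ℂ => a + t • b) (𝓝 t₀)
    (𝓝 (a + t₀ • b)) :=
  Continuous.tendsto (by fun_prop) t₀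

theorem ComplexAnalyticOn.holomorphicAlongLines [PolynormableSpace ℂ F] {f : F → G} {U : Set F}
    (hU : IsOpen U) (hf : ComplexAnalyticOn f U) : HolomorphicAlongLines f U := by
  intro l a b t₀ ht₀
  obtain ⟨P, hP⟩ := hf.exists_scalar_series ht₀ l
  refine differentiableAt_comp_of_tendsto (g := fun x => l (f x)) (γ := fun t => a + t • b)
    (q := fun k => if k = 0 then a + t₀ • b else if k = 1 then b else 0)
    (l.continuous.continuousAt.comp (hf.1.continuousAt (hU.mem_nhds ht₀))) hP rfl ?_
  refine Eventually.of_forall fun t => tendsto_const_nhds.congr' ?_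
  filter_upwards [eventually_ge_atTop 2] with n hn
  obtain ⟨m, rfl⟩ := Nat.exists_eq_add_of_le' hn
  rw [Finset.sum_range_succ', Finset.sum_range_succ', Finset.sum_eq_zero fun k _ => by simp]
  simp only [zero_add, pow_one, one_ne_zero, if_true, if_false, pow_zero, one_smul, sub_smul]
  abel

/-- On a line with direction `b` the expansion of `f` becomes a power series in `t - t₀` with
coefficients `p k (b, …, b)`. Analyticity of the composite itself is never needed. -/
theorem ComplexAnalyticOn.holomorphicAlongLines_comp [ContinuousSMul ℂ F]
    [IsTopologicalAddGroup G] [PolynormableSpace ℂ G] [T2Space G]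
    {H : Type*} [AddCommGroup H] [Module ℂ H] [TopologicalSpace H]
    {f : F → G} {g : G → H} {U : Set F} {V : Set G} (hV : IsOpen V)
    (hf : ComplexAnalyticOn f U) (hg : ComplexAnalyticOn g V) :
    HolomorphicAlongLines (fun x => g (f x)) (U ∩ f ⁻¹' V) := by
  rintro l a b t₀ ⟨ht₀, ht₀'⟩
  obtain ⟨P, hP⟩ := hg.exists_scalar_series ht₀' l
  obtain ⟨p, hp⟩ := hf.2 _ ht₀
  have hser : ∀ᶠ t in 𝓝 t₀, Tendsto (fun n : ℕ => ∑ k ∈ Finset.range n,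
      (t - t₀) ^ k • p k (fun _ => b)) atTop (𝓝 (f (a + t • b))) := by
    filter_upwards [(tendsto_line a b t₀).eventually hp] with t ht
    refine ht.congr fun n => Finset.sum_congr rfl fun k _ => ?_
    have e : a + t • b - (a + t₀ • b) = (t - t₀) • b := by rw [sub_smul]; abel
    have := (p k).map_smul_univ (fun _ => t - t₀) (fun _ => b)
    simpa [e] using this
  have h0 : p 0 (fun _ => b) = f (a + t₀ • b) := by
    refine tendsto_nhds_unique (tendsto_const_nhds.congr' ?_) hser.self_of_nhds
    filter_upwards [eventually_ge_atTop 1] with n hn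
    rw [Finset.sum_eq_single_of_mem 0 (Finset.mem_range.2 hn)]
    · simp
    · intro k _ hk
      simp [hk]
  exact differentiableAt_comp_of_tendsto (g := fun x => l (g x)) (γ := fun t => f (a + t • b))
    (l.continuous.continuousAt.comp (hg.1.continuousAt (hV.mem_nhds ht₀'))) hP h0 hser

end Analytic

/-! ### The identity theorem at real points -/

section Identity

variable {E : Type*} [AddCommGroup E] [Module ℝ E] [TopologicalSpace E]
  [IsTopologicalAddGroup E] [ContinuousSMul ℝ E]

/-- At the real point itself the line is constant, since the imaginary part vanishes; compactness of
the disc makes the neighbourhood uniform in `t`. -/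
theorem Cx.eventually_line_mem {W : Set (Cx E)} (hW : IsOpen W) {x : E} (hx : Cx.ofReal x ∈ W)
    (r : ℝ) : ∀ᶠ z in 𝓝 (Cx.ofReal x), ∀ t ∈ Metric.closedBall (0 : ℂ) r,
      Cx.ofReal z.re + t • Cx.ofReal z.im ∈ W := by
  refine (isCompact_closedBall (0 : ℂ) r).eventually_forall_of_forall_eventually fun t _ => ?_
  have hc : Continuous fun y : Cx E × ℂ => Cx.ofReal y.1.re + y.2 • Cx.ofReal y.1.im :=
    (Cx.continuous_ofReal.comp (Cx.continuous_re.comp continuous_fst)).add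
      (continuous_snd.smul (Cx.continuous_ofReal.comp (Cx.continuous_im.comp continuous_fst)))
  refine hc.continuousAt.eventually (hW.mem_nhds ?_)
  have : Cx.ofReal (0 : E) = 0 := rfl
  change Cx.ofReal x + t • Cx.ofReal (0 : E) ∈ W
  rwa [this, smul_zero, add_zero]

/-- Identity theorem: maps holomorphic along lines which agree at the real points of an open set
agree near these points. -/
theorem HolomorphicAlongLines.eventuallyEq_of_eq_ofReal [LocallyConvexSpace ℝ E] [T2Space E]
    {f g : Cx E → Cx E} {W : Set (Cx E)}
    (hW : IsOpen W) (hf : HolomorphicAlongLines f W) (hg : HolomorphicAlongLines g W)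
    (h : ∀ y, Cx.ofReal y ∈ W → f (Cx.ofReal y) = g (Cx.ofReal y)) {x : E}
    (hx : Cx.ofReal x ∈ W) : ∀ᶠ z in 𝓝 (Cx.ofReal x), f z = g z := by
  -- Radius `2` places the parameter `Complex.I`, at which the line passes through `z`, in the open
  -- disc.
  filter_upwards [Cx.eventually_line_mem hW hx 2] with z hz
  have hreal : ∀ t : ℝ, Cx.ofReal z.re + (t : ℂ) • Cx.ofReal z.im =
      Cx.ofReal (z.re + t • z.im) := by
    intro t
    refine Cx.ext ?_ ?_
    · rw [Cx.add_re, Cx.smul_re]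
      simp [Cx.re_ofReal, Cx.im_ofReal]
    · rw [Cx.add_im, Cx.smul_im]
      simp [Cx.re_ofReal, Cx.im_ofReal]
  have hI : Cx.ofReal z.re + Complex.I • Cx.ofReal z.im = z := by
    refine Cx.ext ?_ ?_
    · simp [Cx.add_re, Cx.smul_re, Cx.re_ofReal, Cx.im_ofReal]
    · simp [Cx.add_im, Cx.smul_im, Cx.re_ofReal, Cx.im_ofReal]
  refine Cx.eq_of_forall_dual_eq fun l => ?_
  have han : ∀ k : Cx E → Cx E, HolomorphicAlongLines k W →
      AnalyticOnNhd ℂ (fun t => l (k (Cx.ofReal z.re + t • Cx.ofReal z.im)))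
        (Metric.ball (0 : ℂ) 2) := fun k hk =>
    DifferentiableOn.analyticOnNhd (fun t ht =>
      (hk l _ _ t (hz t (Metric.ball_subset_closedBall ht))).differentiableWithinAt)
      Metric.isOpen_ball
  have hfreq : ∃ᶠ t in 𝓝[≠] (0 : ℂ), l (f (Cx.ofReal z.re + t • Cx.ofReal z.im)) =
      l (g (Cx.ofReal z.re + t • Cx.ofReal z.im)) := by
    have hu : Tendsto (fun n : ℕ => (((1 : ℝ) / (n + 1) : ℝ) : ℂ)) atTop (𝓝[≠] 0) := by
      refine tendsto_nhdsWithin_iff.2 ⟨?_, Eventually.of_forall fun n => ?_⟩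
      · have := (Complex.continuous_ofReal.tendsto 0).comp
          (tendsto_one_div_add_atTop_nhds_zero_nat (𝕜 := ℝ))
        rw [Complex.ofReal_zero] at this
        exact this
      · have : (1 : ℝ) / (n + 1) ≠ 0 := by positivity
        exact Complex.ofReal_ne_zero.2 this
    refine hu.frequently (Eventually.frequently (Eventually.of_forall fun n => ?_))
    have hmem := hz (((1 : ℝ) / (n + 1) : ℝ) : ℂ) (by
      rw [mem_closedBall_zero_iff, Complex.norm_real, Real.norm_of_nonneg (by positivity),
        div_le_iff₀ (by positivity)]
      have : (0 : ℝ) ≤ n := n.cast_nonneg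
      linarith)
    rw [hreal] at hmem ⊢
    rw [h _ hmem]
  have := (han f hf).eqOn_of_preconnected_of_frequently_eq (han g hg)
    (convex_ball (0 : ℂ) 2).isPreconnected (Metric.mem_ball_self two_pos) hfreq
    (show Complex.I ∈ Metric.ball (0 : ℂ) 2 by simp)
  simpa only [hI] using this

end Identity

/-! ### Separation in normal spaces -/

section Separation

variable {Y : Type*} [TopologicalSpace Y]

/-- In a normal space, if closed sets `D l` have no common point along closed maps `f l` on a closed
set `T`, then neither have suitable open neighbourhoods of the `D l`. -/
theorem exists_isOpen_superset_of_isClosed_image [NormalSpace Y] {ι : Type*} [Finite ι]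
    {T : Set Y} (hT : IsClosed T) {f : ι → Y → Y} (hf : ∀ l, ContinuousOn (f l) T)
    (hfT : ∀ l, ∀ A ⊆ T, IsClosed A → IsClosed (f l '' A)) {D : ι → Set Y}
    (hD : ∀ l, IsClosed (D l)) (hTD : ∀ t ∈ T, ∃ l, f l t ∉ D l) :
    ∃ O : ι → Set Y, (∀ l, IsOpen (O l)) ∧ (∀ l, D l ⊆ O l) ∧ ∀ t ∈ T, ∃ l, f l t ∉ O l := by
  have hcl : ∀ l, IsClosed (T ∩ f l ⁻¹' D l) := fun l =>
    (hf l).preimage_isClosed_of_isClosed hT (hD l)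
  -- The sets of points not sent into `D l` by `f l` cover `T`. In a closed shrinking `v` of this
  -- cover, the image of `T ∩ v l` under `f l` is closed and misses `D l`; its complement serves as
  -- `O l`.
  obtain ⟨v, hTv, hv, hvu⟩ := exists_subset_iUnion_closed_subset hT
    (u := fun l => (T ∩ f l ⁻¹' D l)ᶜ) (fun l => (hcl l).isOpen_compl)
    (fun x _ => Set.toFinite _) (fun t ht => by
      obtain ⟨l, hl⟩ := hTD t ht
      exact mem_iUnion.2 ⟨l, fun h => hl h.2⟩)
  refine ⟨fun l => (f l '' (T ∩ v l))ᶜ,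
    fun l => (hfT l _ inter_subset_left (hT.inter (hv l))).isOpen_compl, ?_, ?_⟩
  · rintro l _ hd ⟨t, ⟨htT, htv⟩, rfl⟩
    exact hvu l htv ⟨htT, hd⟩
  · intro t ht
    obtain ⟨l, hl⟩ := mem_iUnion.1 (hTv ht)
    exact ⟨l, fun h => h ⟨t, ⟨ht, hl⟩, rfl⟩⟩

end Separation

/-! ### Shrinking transition maps to a gluable family -/

section Gluing

variable {ι Y : Type*} [TopologicalSpace Y]

/-- A family of mutually inverse homeomorphisms `h i j : W i j → W j i` between open subsets. -/
structure IsTransitionFamily (W : ι → ι → Set Y) (h : ι → ι → Y → Y) : Prop where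
  isOpen : ∀ i j, IsOpen (W i j)
  continuousOn : ∀ i j, ContinuousOn (h i j) (W i j)
  mapsTo : ∀ i j, MapsTo (h i j) (W i j) (W j i)
  leftInvOn : ∀ i j, LeftInvOn (h j i) (h i j) (W i j)

/-- The open sets `V i` can be glued along the maps `h i j` to a regular Hausdorff space. -/
structure IsGluable (W : ι → ι → Set Y) (h : ι → ι → Y → Y) (V : ι → Set Y) : Prop where
  isOpen : ∀ i, IsOpen (V i)
  refl : ∀ i, ∀ z ∈ V i, z ∈ W i i ∧ h i i z = z
  trans : ∀ i j k, ∀ z ∈ V i, z ∈ W i j → h i j z ∈ V j → h i j z ∈ W j k →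
    h j k (h i j z) ∈ V k → z ∈ W i k ∧ h i k z = h j k (h i j z)
  -- A point of `V i` outside the domain `W i j` stays away from the overlap with `V j`; this
  -- excludes non-separated pairs of points.
  closure_subset : ∀ i j, closure (V i ∩ W i j ∩ h i j ⁻¹' V j) ∩ V i ⊆ W i j

theorem IsGluable.mono {W : ι → ι → Set Y} {h : ι → ι → Y → Y} {V V' : ι → Set Y}
    (hV : IsGluable W h V) (hV' : ∀ i, IsOpen (V' i)) (hsub : ∀ i, V' i ⊆ V i) :
    IsGluable W h V' where
  isOpen := hV'
  refl i z hz := hV.refl i z (hsub i hz)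
  trans i j k z h1 h2 h3 h4 h5 := hV.trans i j k z (hsub _ h1) h2 (hsub _ h3) h4 (hsub _ h5)
  closure_subset i j := (inter_subset_inter (closure_mono (inter_subset_inter
    (inter_subset_inter_left _ (hsub i)) (preimage_mono (hsub j)))) (hsub i)).trans
      (hV.closure_subset i j)

/-- The image is a preimage under the inverse map, which is continuous on the closed set `closure
(W' j i)`. -/
theorem IsTransitionFamily.isClosed_image {W W' : ι → ι → Set Y} {h : ι → ι → Y → Y}
    (hW : IsTransitionFamily W h) (hW' : IsTransitionFamily W' h)
    (hcl : ∀ i j, closure (W' i j) ⊆ W i j) {i j : ι} {A : Set Y} (hA : IsClosed A)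
    (hAW : A ⊆ closure (W' i j)) : IsClosed (h i j '' A) := by
  have hmaps : ∀ i j, MapsTo (h i j) (closure (W' i j)) (closure (W' j i)) := fun i j =>
    (hW'.mapsTo i j).closure_of_continuousOn ((hW.continuousOn i j).mono (hcl i j))
  have : h i j '' A = closure (W' j i) ∩ h j i ⁻¹' A := by
    ext w
    constructor
    · rintro ⟨z, hz, rfl⟩
      refine ⟨hmaps i j (hAW hz), ?_⟩
      rwa [mem_preimage, hW.leftInvOn i j (hcl i j (hAW hz))]
    · rintro ⟨hw, hwA⟩
      exact ⟨h j i w, hwA, hW.leftInvOn j i (hcl j i hw)⟩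
  rw [this]
  exact ((hW.continuousOn j i).mono (hcl j i)).preimage_isClosed_of_isClosed isClosed_closure hA

/-- Transition maps can be restricted to smaller open sets whose closures lie in the original
domains, and which still contain prescribed closed sets. -/
theorem IsTransitionFamily.exists_shrink [NormalSpace Y] {W : ι → ι → Set Y} {h : ι → ι → Y → Y}
    (hW : IsTransitionFamily W h) {A : ι → ι → Set Y} (hA : ∀ i j, IsClosed (A i j))
    (hAW : ∀ i j, A i j ⊆ W i j) (hAh : ∀ i j, MapsTo (h i j) (A i j) (A j i)) :
    ∃ W' : ι → ι → Set Y, IsTransitionFamily W' h ∧ (∀ i j, A i j ⊆ W' i j) ∧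
      ∀ i j, closure (W' i j) ⊆ W i j := by
  choose P hPo hAP hPW using fun i j => normal_exists_closure_subset (hA i j) (hW.isOpen i j)
    (hAW i j)
  have hPW' : ∀ i j, P i j ⊆ W i j := fun i j => subset_closure.trans (hPW i j)
  refine ⟨fun i j => P i j ∩ h i j ⁻¹' P j i, ⟨fun i j => ?_, fun i j => ?_, fun i j z hz => ?_,
    fun i j z hz => ?_⟩, fun i j z hz => ?_, fun i j => ?_⟩
  · exact ((hW.continuousOn i j).mono (hPW' i j)).isOpen_inter_preimage (hPo i j) (hPo j i)
  · exact (hW.continuousOn i j).mono (inter_subset_left.trans (hPW' i j))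
  · refine ⟨hz.2, ?_⟩
    rw [mem_preimage, hW.leftInvOn i j (hPW' i j hz.1)]
    exact hz.1
  · exact hW.leftInvOn i j (hPW' i j hz.1)
  · exact ⟨hAP i j hz, hAP j i (hAh i j hz)⟩
  · exact (closure_mono inter_subset_left).trans (hPW i j)

/-- In a normal space, transition maps satisfying the cocycle condition near the points of closed
sets `D i` can be restricted such that suitable open neighbourhoods of the `D i` can be glued. -/
theorem IsTransitionFamily.exists_isGluable [NormalSpace Y] [Finite ι] {W : ι → ι → Set Y}
    {h : ι → ι → Y → Y} (hW : IsTransitionFamily W h) {D : ι → Set Y} (hD : ∀ i, IsClosed (D i))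
    (hDD : ∀ i j, IsClosed {z | z ∈ D i ∧ z ∈ W i j ∧ h i j z ∈ D j})
    (hrefl : ∀ i, ∀ z ∈ D i, z ∈ W i i ∧ ∀ᶠ x in 𝓝 z, h i i x = x)
    (htrans : ∀ i j k, ∀ z ∈ D i, z ∈ W i j → h i j z ∈ D j → h i j z ∈ W j k →
      z ∈ W i k ∧ ∀ᶠ x in 𝓝 z, h i k x = h j k (h i j x)) :
    ∃ (W' : ι → ι → Set Y) (V : ι → Set Y), IsTransitionFamily W' h ∧
      (∀ i j, W' i j ⊆ W i j) ∧
      (∀ i j, ∀ z ∈ D i, z ∈ W i j → h i j z ∈ D j → z ∈ W' i j) ∧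
      (∀ i, D i ⊆ V i) ∧ IsGluable W' h V := by
  obtain ⟨W', hW', hDW', hcl⟩ := hW.exists_shrink hDD (fun i j z hz => hz.2.1)
    (fun i j z hz => ⟨hz.2.2, hW.mapsTo i j hz.2.1, by
      rw [hW.leftInvOn i j hz.2.1]; exact hz.1⟩)
  -- A second shrinking `N`, with closures inside `W'`, is what later yields `closure_subset`.
  have hsub : ∀ i j, W' i j ⊆ W i j := fun i j => subset_closure.trans (hcl i j)
  choose N hNo hDN hNW using fun i j =>
    normal_exists_closure_subset (hDD i j) (hW'.isOpen i j) (hDW' i j)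
  let G : ι → ι → ι → Set Y := fun i j k =>
    N i k ∩ interior {x | h i k x = h j k (h i j x)}
  -- The bad points. Taking closures of `W'` makes `T` closed, while the maps remain continuous on
  -- it because `closure (W' i j) ⊆ W i j`.
  let T : ι → ι → ι → Set Y := fun i j k =>
    (closure (W' i j) ∩ h i j ⁻¹' closure (W' j k)) ∩ (G i j k)ᶜ
  have hTcl : ∀ i j k, IsClosed (T i j k) := fun i j k =>
    (((hW.continuousOn i j).mono (hcl i j)).preimage_isClosed_of_isClosed isClosed_closure
      isClosed_closure).inter ((hNo i k).inter isOpen_interior).isClosed_compl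
  have hsep : ∀ t : ι × ι × ι, ∃ O : Fin 3 → Set Y, (∀ l, IsOpen (O l)) ∧
      (∀ l, D (![t.1, t.2.1, t.2.2] l) ⊆ O l) ∧ ∀ z ∈ T t.1 t.2.1 t.2.2,
        ∃ l, (![id, h t.1 t.2.1, h t.2.1 t.2.2 ∘ h t.1 t.2.1] : Fin 3 → Y → Y) l z ∉ O l := by
    rintro ⟨i, j, k⟩
    have hc1 : ContinuousOn (h i j) (T i j k) :=
      (hW.continuousOn i j).mono fun z hz => hcl i j hz.1.1
    refine exists_isOpen_superset_of_isClosed_image (hTcl i j k) ?_ ?_ (fun l => hD _) ?_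
    · intro l
      fin_cases l
      · exact continuousOn_id
      · exact hc1
      · exact (hW.continuousOn j k).comp hc1 fun z hz => hcl j k hz.1.2
    · intro l A hA hAc
      have h1 : IsClosed (h i j '' A) :=
        hW.isClosed_image hW' hcl hAc fun z hz => (hA hz).1.1
      fin_cases l
      · simpa using hAc
      · exact h1
      · have := hW.isClosed_image hW' hcl (i := j) (j := k) h1
          (by rintro _ ⟨z, hz, rfl⟩; exact (hA hz).1.2)
        rwa [← image_comp] at this
    · intro z hz
      by_contra! hcon
      have h0 : z ∈ D i := hcon 0
      have h1 : h i j z ∈ D j := hcon 1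
      have h2 : h j k (h i j z) ∈ D k := hcon 2
      obtain ⟨h3, h4⟩ := htrans i j k z h0 (hcl i j hz.1.1) h1 (hcl j k hz.1.2)
      refine hz.2 ⟨hDN i k ⟨h0, h3, ?_⟩, mem_interior_iff_mem_nhds.2 h4⟩
      rwa [h4.self_of_nhds]
  choose O hOo hDO hTO using hsep
  let Q : ι → Set Y := fun i => W' i i ∩ interior {x | h i i x = x}
  -- `V i` lies in every neighbourhood produced for a triple in which `i` occurs, at each position
  -- where it occurs.
  let V : ι → Set Y := fun i => Q i ∩ ⋂ (t : ι × ι × ι) (l : Fin 3)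
    (_ : ![t.1, t.2.1, t.2.2] l = i), O t l
  have hVtrans : ∀ i j k, ∀ z ∈ V i, z ∈ W' i j → h i j z ∈ V j → h i j z ∈ W' j k →
      h j k (h i j z) ∈ V k → z ∈ G i j k := by
    intro i j k z h1 h2 h3 h4 h5
    by_contra hG
    obtain ⟨l, hl⟩ := hTO (i, j, k) z ⟨⟨subset_closure h2, subset_closure h4⟩, hG⟩
    apply hl
    fin_cases l
    · exact mem_iInter.1 (mem_iInter₂.1 h1.2 (i, j, k) 0) rfl
    · exact mem_iInter.1 (mem_iInter₂.1 h3.2 (i, j, k) 1) rfl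
    · exact mem_iInter.1 (mem_iInter₂.1 h5.2 (i, j, k) 2) rfl
  have hVrefl : ∀ i, ∀ z ∈ V i, z ∈ W' i i ∧ h i i z = z := fun i z hz =>
    ⟨hz.1.1, (interior_subset hz.1.2 : z ∈ {x | h i i x = x})⟩
  refine ⟨W', V, hW', hsub, fun i j z h1 h2 h3 => hDW' i j ⟨h1, h2, h3⟩, fun i z hz => ?_,
    ⟨fun i => ?_, hVrefl, fun i j k z h1 h2 h3 h4 h5 => ?_, fun i j => ?_⟩⟩
  · obtain ⟨h1, h2⟩ := hrefl i z hz
    refine ⟨⟨hDW' i i ⟨hz, h1, ?_⟩, mem_interior_iff_mem_nhds.2 h2⟩,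
      mem_iInter₂.2 fun t l => mem_iInter.2 fun hl => hDO t l (hl ▸ hz)⟩
    rwa [h2.self_of_nhds]
  · exact ((hW'.isOpen i i).inter isOpen_interior).inter (isOpen_iInter_of_finite fun t =>
      isOpen_iInter_of_finite fun l => isOpen_iInter_of_finite fun _ => hOo t l)
  · have hG := hVtrans i j k z h1 h2 h3 h4 h5
    exact ⟨hNW i k (subset_closure hG.1),
      (interior_subset hG.2 : z ∈ {x | h i k x = h j k (h i j x)})⟩
  -- The triple `(i, j, j)` shows that the overlap lies in `N i j`.
  · refine inter_subset_left.trans ((closure_mono ?_).trans (hNW i j))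
    rintro z ⟨⟨h1, h2⟩, h3⟩
    obtain ⟨h4, h5⟩ := hVrefl j _ h3
    exact (hVtrans i j j z h1 h2 h3 h4 (by rw [h5]; exact h3)).1

end Gluing

/-! ### The glued space and its regularity -/

section Glued

variable {ι Y : Type*} [TopologicalSpace Y] {W : ι → ι → Set Y} {h : ι → ι → Y → Y}
  {V : ι → Set Y}

/-- Points of `V i` have neighbourhoods in which closed sets remain closed when transported
to `V j`. -/
theorem IsGluable.exists_nhds_isClosed_transport [RegularSpace Y] (hV : IsGluable W h V)
    (hW : IsTransitionFamily W h) {i j : ι} {z : Y} (hz : z ∈ V i) :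
    ∃ R ∈ 𝓝 z, ∀ A ⊆ R ∩ V i, IsClosed A → IsClosed {w : V j | (w : Y) ∈ W j i ∧ h j i w ∈ A} := by
  by_cases hzW : z ∈ W i j
  · obtain ⟨B, hB, hBc, hBW⟩ := exists_mem_nhds_isClosed_subset
      ((hW.isOpen j i).mem_nhds (hW.mapsTo i j hzW))
    refine ⟨h i j ⁻¹' B, ((hW.continuousOn i j).continuousAt
      ((hW.isOpen i j).mem_nhds hzW)).preimage_mem_nhds hB, fun A hA hAc => ?_⟩
    have : {w : V j | (w : Y) ∈ W j i ∧ h j i w ∈ A} = Subtype.val ⁻¹' (B ∩ h j i ⁻¹' A) := by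
      ext w
      constructor
      · rintro ⟨h1, h2⟩
        have := (hA h2).1
        rw [mem_preimage, hW.leftInvOn j i h1] at this
        exact ⟨this, h2⟩
      · rintro ⟨h1, h2⟩
        exact ⟨hBW h1, h2⟩
    rw [this]
    exact (((hW.continuousOn j i).mono hBW).preimage_isClosed_of_isClosed hBc hAc).preimage
      continuous_subtype_val
  -- Outside `W i j`, the point `z` has a neighbourhood disjoint from the overlap, so nothing is
  -- transported to `V j`.
  · refine ⟨(closure (V i ∩ W i j ∩ h i j ⁻¹' V j))ᶜ, isClosed_closure.isOpen_compl.mem_nhds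
      fun hcl => hzW (hV.closure_subset i j ⟨hcl, hz⟩), fun A hA _ => ?_⟩
    convert isClosed_empty
    refine eq_empty_of_forall_notMem ?_
    rintro w ⟨h1, h2⟩
    refine (hA h2).1 (subset_closure ⟨⟨(hA h2).2, hW.mapsTo j i h1⟩, ?_⟩)
    rw [mem_preimage, hW.leftInvOn j i h1]
    exact w.2

/-- The equivalence relation on the disjoint union of the `V i` which identifies `z` with
`h i j z`. -/
def gluingSetoid (hW : IsTransitionFamily W h) (hV : IsGluable W h V) : Setoid (Σ i, V i) where
  r a b := (a.2 : Y) ∈ W a.1 b.1 ∧ h a.1 b.1 a.2 = b.2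
  iseqv :=
    { refl := fun a => hV.refl a.1 a.2 a.2.2
      symm := fun {a b} hab => by
        rw [← hab.2]
        exact ⟨hW.mapsTo _ _ hab.1, hW.leftInvOn _ _ hab.1⟩
      trans := fun {a b c} hab hbc => by
        rw [← hab.2] at hbc
        obtain ⟨h1, h2⟩ := hV.trans a.1 b.1 c.1 a.2 a.2.2 hab.1 (hab.2 ▸ b.2.2) hbc.1
          (hbc.2 ▸ c.2.2)
        exact ⟨h1, h2.trans hbc.2⟩ }

/-- The space glued from the `V i`. -/
def GluedSpace (hW : IsTransitionFamily W h) (hV : IsGluable W h V) : Type _ :=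
  Quotient (gluingSetoid hW hV)

namespace GluedSpace

variable (hW : IsTransitionFamily W h) (hV : IsGluable W h V)

instance : TopologicalSpace (GluedSpace hW hV) :=
  inferInstanceAs (TopologicalSpace (Quotient (gluingSetoid hW hV)))

/-- The inclusion of `V i` into the glued space. -/
def incl (i : ι) (z : V i) : GluedSpace hW hV := Quotient.mk (gluingSetoid hW hV) ⟨i, z⟩

theorem incl_eq_incl_iff {i j : ι} {z : V i} {w : V j} :
    incl hW hV i z = incl hW hV j w ↔ (z : Y) ∈ W i j ∧ h i j z = w :=
  Quotient.eq (r := gluingSetoid hW hV)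

theorem exists_incl_eq (x : GluedSpace hW hV) : ∃ i z, incl hW hV i z = x := by
  induction x using Quotient.inductionOn with
  | h a => exact ⟨a.1, a.2, rfl⟩

theorem isOpen_iff {s : Set (GluedSpace hW hV)} :
    IsOpen s ↔ ∀ j, IsOpen (incl hW hV j ⁻¹' s) := by
  have hq : IsQuotientMap (Quotient.mk (gluingSetoid hW hV)) := isQuotientMap_quotient_mk'
  refine hq.isOpen_preimage.symm.trans isOpen_sigma_iff

theorem isClosed_iff {s : Set (GluedSpace hW hV)} :
    IsClosed s ↔ ∀ j, IsClosed (incl hW hV j ⁻¹' s) := by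
  simp only [← isOpen_compl_iff, isOpen_iff, preimage_compl]

theorem continuous_incl (i : ι) : Continuous (incl hW hV i) :=
  continuous_def.2 fun _ hs => (isOpen_iff hW hV).1 hs i

theorem preimage_image_incl (i j : ι) (A : Set (V i)) :
    incl hW hV j ⁻¹' (incl hW hV i '' A) =
      {w : V j | (w : Y) ∈ W j i ∧ h j i w ∈ Subtype.val '' A} := by
  ext w
  constructor
  · rintro ⟨z, hz, hzw⟩
    obtain ⟨h1, h2⟩ := (incl_eq_incl_iff hW hV).1 hzw.symm
    exact ⟨h1, z, hz, h2.symm⟩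
  · rintro ⟨h1, z, hz, h2⟩
    exact ⟨z, hz, ((incl_eq_incl_iff hW hV).2 ⟨h1, h2.symm⟩).symm⟩

theorem isOpenEmbedding_incl (i : ι) : IsOpenEmbedding (incl hW hV i) := by
  refine .of_continuous_injective_isOpenMap (continuous_incl hW hV i) ?_ ?_
  · intro z w hzw
    obtain ⟨-, h2⟩ := (incl_eq_incl_iff hW hV).1 hzw
    rw [(hV.refl i z z.2).2] at h2
    exact Subtype.ext h2
  · intro A hA
    refine (isOpen_iff hW hV).2 fun j => ?_
    rw [preimage_image_incl]
    exact ((hW.continuousOn j i).isOpen_inter_preimage (hW.isOpen j i)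
      ((hV.isOpen i).isOpenMap_subtype_val A hA)).preimage continuous_subtype_val

instance [T1Space Y] : T1Space (GluedSpace hW hV) := by
  refine ⟨fun x => ?_⟩
  obtain ⟨i, z, rfl⟩ := exists_incl_eq hW hV x
  rw [isClosed_iff, ← image_singleton]
  intro j
  rw [preimage_image_incl, image_singleton]
  refine Set.Subsingleton.isClosed ?_
  rintro w ⟨h1, h2⟩ w' ⟨h1', h2'⟩
  refine Subtype.ext ?_
  rw [← hW.leftInvOn j i h1, ← hW.leftInvOn j i h1', h2, h2']

/-- Closedness is tested in each `V j`. A closed neighbourhood inside the finitely many sets `R j`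
has closed trace in all of them. -/
instance [RegularSpace Y] [Finite ι] : RegularSpace (GluedSpace hW hV) := by
  refine RegularSpace.of_exists_mem_nhds_isClosed_subset fun x s hs => ?_
  obtain ⟨i, z, rfl⟩ := exists_incl_eq hW hV x
  choose R hR hRA using fun j => hV.exists_nhds_isClosed_transport hW (i := i) (j := j) z.2
  have hs' : Subtype.val '' (incl hW hV i ⁻¹' s) ∈ 𝓝 (z : Y) :=
    (hV.isOpen i).isOpenMap_subtype_val.image_mem_nhds
      ((continuous_incl hW hV i).continuousAt.preimage_mem_nhds hs)
  obtain ⟨A, hA, hAc, hAs⟩ := exists_mem_nhds_isClosed_subset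
    (inter_mem hs' (iInter_mem.2 hR))
  have hAV : A ⊆ V i := fun y hy => by
    obtain ⟨v, -, rfl⟩ := (hAs hy).1
    exact v.2
  refine ⟨incl hW hV i '' (Subtype.val ⁻¹' A), ?_, ?_, ?_⟩
  · exact (isOpenEmbedding_incl hW hV i).isOpenMap.image_mem_nhds
      (continuous_subtype_val.continuousAt.preimage_mem_nhds hA)
  · refine (isClosed_iff hW hV).2 fun j => ?_
    rw [preimage_image_incl, Subtype.image_preimage_coe, inter_eq_right.2 hAV]
    exact hRA j A (fun y hy => ⟨mem_iInter.1 (hAs hy).2 j, hAV hy⟩) hAc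
  · rintro _ ⟨v, hv, rfl⟩
    obtain ⟨w, hw, hwv⟩ := (hAs hv).1
    rw [← Subtype.ext hwv]
    exact hw

/-- The chart of the glued space inverse to the inclusion of `V i`. -/
noncomputable def chart (i : ι) (hne : (V i).Nonempty) :
    OpenPartialHomeomorph (GluedSpace hW hV) Y :=
  haveI : Nonempty (V i) := hne.to_subtype
  (isOpenEmbedding_incl hW hV i).toOpenPartialHomeomorph.symm.trans
    ((⟨V i, hV.isOpen i⟩ : TopologicalSpace.Opens Y).openPartialHomeomorphSubtypeCoe
      hne.to_subtype)

theorem chart_source (i : ι) (hne : (V i).Nonempty) :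
    (chart hW hV i hne).source = range (incl hW hV i) := by
  simp [chart]

theorem chart_target (i : ι) (hne : (V i).Nonempty) : (chart hW hV i hne).target = V i := by
  simp [chart]

theorem chart_incl (i : ι) (hne : (V i).Nonempty) (z : V i) :
    chart hW hV i hne (incl hW hV i z) = z := by
  have : Nonempty (V i) := hne.to_subtype
  have := (isOpenEmbedding_incl hW hV i).toOpenPartialHomeomorph.left_inv (x := z) (by simp)
  exact congrArg Subtype.val this

theorem chart_symm_apply (i : ι) (hne : (V i).Nonempty) {z : Y} (hz : z ∈ V i) :
    (chart hW hV i hne).symm z = incl hW hV i ⟨z, hz⟩ := by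
  have := (chart hW hV i hne).left_inv (x := incl hW hV i ⟨z, hz⟩)
    (by rw [chart_source]; exact ⟨_, rfl⟩)
  rwa [chart_incl] at this

end GluedSpace

end Glued

/-! ### Complex analytic extensions of chart changes -/

section Transition

variable {E : Type*} [AddCommGroup E] [Module ℝ E] [TopologicalSpace E]

theorem RealAnalyticOn.mono_congr {F : Type*} [AddCommGroup F] [Module ℝ F] [TopologicalSpace F]
    {f f' : E → F} {U V : Set E} (hf : RealAnalyticOn f U) (hVU : V ⊆ U)
    (h : ∀ x ∈ V, f' x = f x) : RealAnalyticOn f' V := by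
  obtain ⟨W, g, hW, hUW, hg, hgf⟩ := hf
  exact ⟨W, g, hW, (image_mono hVU).trans hUW, hg, fun x hx => by rw [hgf x (hVU hx), h x hx]⟩

variable {M : Type*} [TopologicalSpace M]

/-- Charts of an open subset inherit real analytic chart changes. -/
theorem RealAnalyticOn.of_restriction {Ω : TopologicalSpace.Opens M}
    {e e' : OpenPartialHomeomorph M E} {d d' : OpenPartialHomeomorph Ω E}
    (hd : ∀ y ∈ d.source, (y : M) ∈ e.source ∧ d y = e y)
    (hd' : ∀ y ∈ d'.source, (y : M) ∈ e'.source ∧ d' y = e' y)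
    (h : RealAnalyticOn (e.symm ≫ₕ e') (e.symm ≫ₕ e').source) :
    RealAnalyticOn (d.symm ≫ₕ d') (d.symm ≫ₕ d').source := by
  have key : ∀ u ∈ (d.symm ≫ₕ d').source, e.symm u = (d.symm u : M) ∧ u ∈ e.target := by
    rintro u ⟨hu, -⟩
    obtain ⟨h1, h2⟩ := hd _ (d.map_target hu)
    have h3 : e (d.symm u) = u := h2.symm.trans (d.right_inv hu)
    exact ⟨by rw [← e.left_inv h1, h3], h3 ▸ e.map_source h1⟩
  refine h.mono_congr (fun u hu => ⟨(key u hu).2, ?_⟩) fun u hu => ?_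
  · change e.symm u ∈ e'.source
    rw [(key u hu).1]
    exact (hd' _ hu.2).1
  · change d' (d.symm u) = e' (e.symm u)
    rw [(key u hu).1]
    exact (hd' _ hu.2).2

variable [ChartedSpace E M] [IsTopologicalAddGroup E] [ContinuousSMul ℝ E]
  [LocallyConvexSpace ℝ E] [T2Space E]

/-- The changes between charts of an atlas extend to mutually inverse complex analytic maps. -/
theorem IsRealAnalyticManifold.exists_isTransitionFamily (hM : IsRealAnalyticManifold E M)
    {ι : Type*} {c : ι → OpenPartialHomeomorph M E} (hc : ∀ i, c i ∈ atlas E M) :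
    ∃ (W : ι → ι → Set (Cx E)) (h : ι → ι → Cx E → Cx E), IsTransitionFamily W h ∧
      (∀ i j, ComplexAnalyticOn (h i j) (W i j)) ∧
      (∀ i j y, Cx.ofReal y ∈ W i j → ∃ x ∈ (c i).source, x ∈ (c j).source ∧ c i x = y) ∧
      ∀ i j, ∀ x ∈ (c i).source, x ∈ (c j).source →
        Cx.ofReal (c i x) ∈ W i j ∧ h i j (Cx.ofReal (c i x)) = Cx.ofReal (c j x) := by
  choose S g hSo hS hg hgr using fun i j => hM.compatible (c i) (hc i) (c j) (hc j)
  have hsrc : ∀ i j, ∀ x ∈ (c i).source, x ∈ (c j).source →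
      c i x ∈ ((c i).symm ≫ₕ c j).source := fun i j x hx hx' =>
    ⟨(c i).map_source hx, by
      change (c i).symm (c i x) ∈ (c j).source
      rwa [(c i).left_inv hx]⟩
  have hgc : ∀ i j, ∀ x ∈ (c i).source, x ∈ (c j).source →
      g i j (Cx.ofReal (c i x)) = Cx.ofReal (c j x) := fun i j x hx hx' => by
    rw [hgr i j _ (hsrc i j x hx hx')]
    change Cx.ofReal (c j ((c i).symm (c i x))) = _
    rw [(c i).left_inv hx]
  -- Restricting the real part leaves no real points beyond the domain of the chart change.
  let S' : ι → ι → Set (Cx E) := fun i j => S i j ∩ Cx.re ⁻¹' ((c i).symm ≫ₕ c j).source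
  have hS'o : ∀ i j, IsOpen (S' i j) := fun i j =>
    (hSo i j).inter (((c i).symm ≫ₕ c j).open_source.preimage Cx.continuous_re)
  have hgS' : ∀ i j, ContinuousOn (g i j) (S' i j) := fun i j =>
    (hg i j).1.mono inter_subset_left
  have hS'c : ∀ i j, ∀ x ∈ (c i).source, x ∈ (c j).source → Cx.ofReal (c i x) ∈ S' i j :=
    fun i j x hx hx' => ⟨hS i j ⟨_, hsrc i j x hx hx', rfl⟩, hsrc i j x hx hx'⟩
  have hS'r : ∀ i j y, Cx.ofReal y ∈ S' i j →
      ∃ x ∈ (c i).source, x ∈ (c j).source ∧ c i x = y := fun i j y hy =>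
    ⟨(c i).symm y, (c i).map_target hy.2.1, hy.2.2, (c i).right_inv hy.2.1⟩
  let A : ι → ι → Set (Cx E) := fun i j => S' i j ∩ g i j ⁻¹' S' j i
  have hAo : ∀ i j, IsOpen (A i j) := fun i j =>
    (hgS' i j).isOpen_inter_preimage (hS'o i j) (hS'o j i)
  have hAc : ∀ i j, ∀ x ∈ (c i).source, x ∈ (c j).source → Cx.ofReal (c i x) ∈ A i j :=
    fun i j x hx hx' => ⟨hS'c i j x hx hx', by
      rw [mem_preimage, hgc i j x hx hx']; exact hS'c j i x hx' hx⟩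
  -- The extensions `g i j` and `g j i` are chosen independently; by the identity theorem they are
  -- mutually inverse near real points.
  let H : ι → ι → Set (Cx E) := fun i j => A i j ∩ interior {z | g j i (g i j z) = z}
  have hHo : ∀ i j, IsOpen (H i j) := fun i j => (hAo i j).inter isOpen_interior
  have hHc : ∀ i j, ∀ x ∈ (c i).source, x ∈ (c j).source → Cx.ofReal (c i x) ∈ H i j := by
    intro i j x hx hx'
    refine ⟨hAc i j x hx hx', mem_interior_iff_mem_nhds.2 ?_⟩
    refine HolomorphicAlongLines.eventuallyEq_of_eq_ofReal (f := fun z => g j i (g i j z))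
      (g := fun z => z) (hAo i j) ?_ (holomorphicAlongLines_id _) ?_ (hAc i j x hx hx')
    · exact ((hg i j).holomorphicAlongLines_comp (hSo j i) (hg j i)).mono
        fun z hz => ⟨hz.1.1, hz.2.1⟩
    · intro y hy
      obtain ⟨x', h1, h2, rfl⟩ := hS'r i j y hy.1
      rw [hgc i j x' h1 h2, hgc j i x' h2 h1]
  have hHinv : ∀ i j, ∀ z ∈ H i j, g j i (g i j z) = z := fun i j z hz =>
    (interior_subset hz.2 : z ∈ {z | g j i (g i j z) = z})
  have hHg : ∀ i j, ContinuousOn (g i j) (H i j) := fun i j =>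
    (hgS' i j).mono fun z hz => hz.1.1
  have hWo : ∀ i j, IsOpen (H i j ∩ g i j ⁻¹' H j i) := fun i j =>
    (hHg i j).isOpen_inter_preimage (hHo i j) (hHo j i)
  refine ⟨fun i j => H i j ∩ g i j ⁻¹' H j i, g, ⟨hWo, fun i j => ?_, fun i j z hz => ?_,
    fun i j z hz => ?_⟩, fun i j => ?_, fun i j y hy => ?_, fun i j x hx hx' => ?_⟩
  · exact (hHg i j).mono inter_subset_left
  · refine ⟨hz.2, ?_⟩
    rw [mem_preimage, hHinv i j z hz.1]
    exact hz.1
  · exact hHinv i j z hz.1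
  · exact (hg i j).mono_congr (hWo i j) (fun z hz => hz.1.1.1.1) fun _ _ => rfl
  · exact hS'r i j y hy.1.1.1
  · refine ⟨⟨hHc i j x hx hx', ?_⟩, hgc i j x hx hx'⟩
    rw [mem_preimage, hgc i j x hx hx']
    exact hHc j i x hx' hx

end Transition

/-! ### Closed neighbourhoods in charts -/

section Topology

variable {E : Type*} [TopologicalSpace E] {M : Type*} [TopologicalSpace M]

/-- A closed set inside a chart domain may have an image that is not closed in `E`. Confining the
image to a closed `C` inside the chart target prevents this. -/
theorem OpenPartialHomeomorph.exists_mem_nhds_isClosed_image [RegularSpace E] [RegularSpace M]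
    (e : OpenPartialHomeomorph M E) {x : M} (hx : x ∈ e.source) :
    ∃ B ∈ 𝓝 x, IsClosed B ∧ B ⊆ e.source ∧ ∀ A ⊆ B, IsClosed A → IsClosed (e '' A) := by
  obtain ⟨C, hC, hCc, hCt⟩ := exists_mem_nhds_isClosed_subset
    (e.open_target.mem_nhds (e.map_source hx))
  obtain ⟨B, hB, hBc, hBs⟩ := exists_mem_nhds_isClosed_subset
    (inter_mem (e.open_source.mem_nhds hx) ((e.continuousAt hx).preimage_mem_nhds hC))
  refine ⟨B, hB, hBc, fun y hy => (hBs hy).1, fun A hA hAc => ?_⟩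
  have : e '' A = C ∩ e.symm ⁻¹' A := by
    ext u
    constructor
    · rintro ⟨y, hy, rfl⟩
      refine ⟨(hBs (hA hy)).2, ?_⟩
      rwa [mem_preimage, e.left_inv (hBs (hA hy)).1]
    · rintro ⟨hu, huA⟩
      exact ⟨e.symm u, huA, e.right_inv (hCt hu)⟩
  rw [this]
  exact (e.continuousOn_symm.mono hCt).preimage_isClosed_of_isClosed hCc hAc

end Topology

/-! ### From compatible charts to a complexification -/

section Assembly

variable {E : Type*} [AddCommGroup E] [TopologicalSpace E]
  {M : Type*} [TopologicalSpace M] {X : Type*} [TopologicalSpace X]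
  {n : ℕ} {c : Fin n → OpenPartialHomeomorph M E} {N : Fin n → Set M}
  {ψ : Fin n → OpenPartialHomeomorph X (Cx E)} {Ω : TopologicalSpace.Opens M} {φ : Ω → X}

theorem isEmbedding_of_charts (hNo : ∀ i, IsOpen (N i)) (hNc : ∀ i, N i ⊆ (c i).source)
    (hΩ : (Ω : Set M) ⊆ ⋃ i, N i) (hφN : ∀ i y, φ y ∈ (ψ i).source ↔ (y : M) ∈ N i)
    (hφ : ∀ i (y : Ω), (y : M) ∈ N i → ψ i (φ y) = Cx.ofReal (c i y)) : IsEmbedding φ := by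
  refine ⟨isInducing_iff_nhds.2 fun y => le_antisymm ?_ ?_, fun y y' hyy' => ?_⟩
  · obtain ⟨i, hi⟩ := mem_iUnion.1 (hΩ y.2)
    refine tendsto_iff_comap.1 ?_
    have hev : ∀ᶠ w : Ω in 𝓝 y, (ψ i).symm (Cx.ofReal (c i w)) = φ w := by
      filter_upwards [((hNo i).preimage continuous_subtype_val).mem_nhds hi] with w hw
      rw [← hφ i w hw, (ψ i).left_inv ((hφN i w).2 hw)]
    refine Tendsto.congr' hev ?_
    rw [← hev.self_of_nhds]
    refine ContinuousAt.comp (f := fun w : Ω => Cx.ofReal (c i w)) (g := (ψ i).symm) ?_ ?_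
    · refine (ψ i).continuousAt_symm ?_
      rw [← hφ i y hi]
      exact (ψ i).map_source ((hφN i y).2 hi)
    · exact Cx.continuous_ofReal.continuousAt.comp
        (((c i).continuousAt (hNc i hi)).comp continuous_subtype_val.continuousAt)
  · obtain ⟨i, hi⟩ := mem_iUnion.1 (hΩ y.2)
    rw [nhds_subtype_eq_comap]
    refine tendsto_iff_comap.1 ?_
    have hsrc := (hφN i y).2 hi
    -- Taking real parts in the chart gives a continuous local left inverse of `φ`.
    have hr : Tendsto (fun x => (c i).symm (ψ i x).re) (𝓝 (φ y)) (𝓝 (y : M)) := by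
      have e : (c i).symm (ψ i (φ y)).re = y := by
        rw [hφ i y hi, Cx.re_ofReal, (c i).left_inv (hNc i hi)]
      have : ContinuousAt (fun x => (c i).symm (ψ i x).re) (φ y) := by
        refine ContinuousAt.comp (f := fun x => (ψ i x).re) (g := (c i).symm) ?_ ?_
        · refine (c i).continuousAt_symm ?_
          rw [hφ i y hi, Cx.re_ofReal]
          exact (c i).map_source (hNc i hi)
        · exact Cx.continuous_re.continuousAt.comp ((ψ i).continuousAt hsrc)
      rw [ContinuousAt, e] at this
      exact this
    refine (hr.comp tendsto_comap).congr' ?_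
    filter_upwards [tendsto_comap.eventually ((ψ i).open_source.mem_nhds hsrc)] with w hw
    have hwN := (hφN i w).1 hw
    change (c i).symm (ψ i (φ w)).re = w
    rw [hφ i w hwN, Cx.re_ofReal, (c i).left_inv (hNc i hwN)]
  · obtain ⟨i, hi⟩ := mem_iUnion.1 (hΩ y.2)
    have hi' : (y' : M) ∈ N i := (hφN i y').1 (hyy' ▸ (hφN i y).2 hi)
    have h1 := hφ i y hi
    rw [hyy', hφ i y' hi'] at h1
    exact Subtype.ext ((c i).injOn (hNc i hi) (hNc i hi') (Cx.ofReal_injective h1).symm)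

/-- An open subset covered by finitely many charts which extend to compatible charts of `X` has
`X` as a complexification. -/
theorem exists_isComplexification_of_charts [Module ℝ E] [ChartedSpace E M]
    (hM : IsRealAnalyticManifold E M) [T2Space X]
    (hc : ∀ i, c i ∈ atlas E M) (hNo : ∀ i, IsOpen (N i)) (hNc : ∀ i, N i ⊆ (c i).source)
    (hNΩ : ∀ i, N i ⊆ Ω) (hne : ∀ i, (N i).Nonempty) (hΩ : (Ω : Set M) ⊆ ⋃ i, N i)
    (hφN : ∀ i y, φ y ∈ (ψ i).source ↔ (y : M) ∈ N i)
    (hφ : ∀ i (y : Ω), (y : M) ∈ N i → ψ i (φ y) = Cx.ofReal (c i y))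
    (hreal : ∀ i u, Cx.ofReal u ∈ (ψ i).target → u ∈ c i '' N i)
    (hcover : ⋃ i, (ψ i).source = univ)
    (hψ : ∀ i j, ComplexAnalyticOn ((ψ i).symm ≫ₕ ψ j) ((ψ i).symm ≫ₕ ψ j).source) :
    ∃ _ : ChartedSpace (Cx E) X, IsComplexification (E := E) φ ∧ IsFinitelyGlued (E := E) φ := by
  have hcov : ∀ x, ∃ i, x ∈ (ψ i).source := fun x => mem_iUnion.1 (hcover ▸ mem_univ x)
  choose k hk using hcov
  let _ : ChartedSpace (Cx E) X :=
    { atlas := range ψ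
      chartAt := fun x => ψ (k x)
      mem_chart_source := hk
      chart_mem_atlas := fun x => mem_range_self _ }
  have hchart : ∀ i, IsComplexAnalyticChart (ψ i) := by
    rintro i _ ⟨j, rfl⟩
    exact ⟨hψ i j, hψ j i⟩
  have hΩne : ∀ i, Nonempty Ω := fun i => (hne i).elim fun x hx => ⟨⟨x, hNΩ i hx⟩⟩
  let d : Fin n → OpenPartialHomeomorph Ω E := fun i =>
    ((c i).restrOpen (N i) (hNo i)).subtypeRestr (hΩne i)
  have hdsrc : ∀ i y, y ∈ (d i).source ↔ (y : M) ∈ N i := fun i y => by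
    have : (d i).source = Subtype.val ⁻¹' ((c i).source ∩ N i) := by
      simp only [d, OpenPartialHomeomorph.subtypeRestr_source,
        OpenPartialHomeomorph.restrOpen_source]
    rw [this]
    exact ⟨fun h => h.2, fun h => ⟨hNc i h, h⟩⟩
  have hdapp : ∀ i (y : Ω), d i y = c i y := fun i y => rfl
  have hdreal : ∀ i, IsRealAnalyticChart (d i) := by
    intro i e' he'
    have hd : ∀ y ∈ (d i).source, (y : M) ∈ (c i).source ∧ d i y = c i y := fun y hy =>
      ⟨hNc i ((hdsrc i y).1 hy), rfl⟩
    obtain ⟨x, rfl⟩ : ∃ x : Ω, (chartAt E (x : M)).subtypeRestr ⟨x⟩ = e' := by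
      simpa [atlas, ChartedSpace.atlas] using he'
    have hd' : ∀ y ∈ ((chartAt E (x : M)).subtypeRestr (s := Ω) ⟨x⟩).source,
        (y : M) ∈ (chartAt E (x : M)).source ∧
          (chartAt E (x : M)).subtypeRestr (s := Ω) ⟨x⟩ y = chartAt E (x : M) y := fun y hy =>
      ⟨by rwa [OpenPartialHomeomorph.subtypeRestr_source] at hy, rfl⟩
    exact ⟨.of_restriction hd hd' (hM.compatible _ (hc i) _ (chart_mem_atlas E _)),
      .of_restriction hd' hd (hM.compatible _ (chart_mem_atlas E _) _ (hc i))⟩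
  have hrestr : ∀ i, RestrictsToChart φ (ψ i) (d i) := by
    refine fun i => ⟨hchart i, hdreal i, ?_, ?_, fun y hy => hφ i y ((hdsrc i y).1 hy)⟩
    · ext z
      constructor
      · rintro ⟨_, ⟨⟨y, rfl⟩, hy⟩, rfl⟩
        exact ⟨⟨_, (hφ i y ((hφN i y).1 hy)).symm⟩, (ψ i).map_source hy⟩
      · rintro ⟨⟨u, rfl⟩, hu⟩
        obtain ⟨y, hy, rfl⟩ := hreal i u hu
        exact ⟨φ ⟨y, hNΩ i hy⟩, ⟨mem_range_self _, (hφN i _).2 hy⟩, hφ i ⟨y, hNΩ i hy⟩ hy⟩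
    · ext y
      rw [hdsrc, mem_preimage, hφN]
  refine ⟨inferInstance, ⟨⟨inferInstance, ?_⟩, isEmbedding_of_charts hNo hNc hΩ hφN hφ, fun y => ?_⟩,
    n, ψ, d, rfl, hrestr, hcover, ?_, fun i j => ⟨hψ i j, ?_⟩⟩
  · rintro _ ⟨i, rfl⟩ _ ⟨j, rfl⟩
    exact hψ i j
  · obtain ⟨i, hi⟩ := mem_iUnion.1 (hΩ y.2)
    exact ⟨ψ i, d i, (hφN i y).2 hi, hrestr i⟩
  · refine eq_univ_of_forall fun y => ?_
    obtain ⟨i, hi⟩ := mem_iUnion.1 (hΩ y.2)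
    exact mem_iUnion.2 ⟨i, (hdsrc i y).2 hi⟩
  · rintro u ⟨hu, hu'⟩
    obtain ⟨y, hy, rfl⟩ : ∃ y ∈ (d i).source, d i y = u :=
      ⟨_, (d i).map_target hu, (d i).right_inv hu⟩
    change (d i).symm (d i y) ∈ (d j).source at hu'
    rw [(d i).left_inv hy, hdsrc] at hu'
    have hyi := (hdsrc i y).1 hy
    have e : (ψ i).symm (Cx.ofReal (d i y)) = φ y := by
      rw [hdapp, ← hφ i y hyi, (ψ i).left_inv ((hφN i y).2 hyi)]
    refine ⟨⟨?_, ?_⟩, ?_⟩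
    · change Cx.ofReal (c i y) ∈ (ψ i).target
      rw [← hφ i y hyi]
      exact (ψ i).map_source ((hφN i y).2 hyi)
    · change (ψ i).symm (Cx.ofReal (d i y)) ∈ (ψ j).source
      rw [e]
      exact (hφN j y).2 hu'
    · change ψ j ((ψ i).symm (Cx.ofReal (d i y))) = Cx.ofReal (d j ((d i).symm (d i y)))
      rw [e, (d i).left_inv hy, hdapp, hφ j y hu']

end Assembly

/-! ### Proof of the theorem -/

theorem theoremA {E : Type v} [AddCommGroup E] [Module ℝ E] [TopologicalSpace E]
    [IsTopologicalAddGroup E] [ContinuousSMul ℝ E] [LocallyConvexSpace ℝ E] [T2Space E]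
    {M : Type u} [TopologicalSpace M] [ChartedSpace E M]
    (hM : IsRealAnalyticManifold E M)
    (hreg : RegularSpace M) (hnormal : NormalSpace (Cx E))
    (K : Set M) (hK : IsCompact K) :
    ∃ Ω : TopologicalSpace.Opens M, K ⊆ (Ω : Set M) ∧
      ∃ (X : Type v) (_ : TopologicalSpace X) (_ : ChartedSpace (Cx E) X) (φ : Ω → X),
        IsComplexification (E := E) φ ∧ T3Space X ∧ IsFinitelyGlued (E := E) φ := by
  choose b hb hbc hbs hbA using fun x : M =>
    (chartAt E x).exists_mem_nhds_isClosed_image (mem_chart_source E x)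
  obtain ⟨t, -, hKt⟩ := hK.elim_nhds_subcover (fun x => interior (b x))
    fun x _ => interior_mem_nhds.2 (hb x)
  let p : Fin t.card → M := fun i => t.equivFin.symm i
  let c : Fin t.card → OpenPartialHomeomorph M E := fun i => chartAt E (p i)
  let B : Fin t.card → Set M := fun i => b (p i)
  -- The closed sets `B i` enter the separation argument; their interiors `N i` form the cover of
  -- `Ω`.
  let N : Fin t.card → Set M := fun i => interior (B i)
  have hc : ∀ i, c i ∈ atlas E M := fun i => chart_mem_atlas E _
  have hBc : ∀ i, B i ⊆ (c i).source := fun i => hbs _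
  have hNB : ∀ i, N i ⊆ B i := fun i => interior_subset
  have hNc : ∀ i, N i ⊆ (c i).source := fun i => (hNB i).trans (hBc i)
  have hNo : ∀ i, IsOpen (N i) := fun i => isOpen_interior
  have hpN : ∀ i, p i ∈ N i := fun i => mem_interior_iff_mem_nhds.2 (hb _)
  obtain ⟨W, h, hW, hana, hWreal, hWc⟩ := hM.exists_isTransitionFamily hc
  have hWmem : ∀ i j, ∀ x ∈ (c i).source, Cx.ofReal (c i x) ∈ W i j → x ∈ (c j).source := by
    intro i j x hx hxW
    obtain ⟨x', h1, h2, h3⟩ := hWreal i j _ hxW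
    rwa [← (c i).injOn h1 hx h3]
  let D : Fin t.card → Set (Cx E) := fun i => Cx.ofReal '' (c i '' B i)
  have hDmem : ∀ i, ∀ x ∈ (c i).source, Cx.ofReal (c i x) ∈ D i → x ∈ B i := by
    rintro i x hx ⟨_, ⟨x', hx', rfl⟩, he⟩
    rwa [← (c i).injOn (hBc i hx') hx (Cx.ofReal_injective he)]
  have hDcl : ∀ i, IsClosed (D i) := fun i =>
    Cx.isClosedEmbedding_ofReal.isClosedMap _ (hbA _ _ subset_rfl (hbc _))
  -- At real points `h i j` is the chart change, so this set is the image of the closed set `B i ∩ B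
  -- j`.
  have hDD : ∀ i j, IsClosed {z | z ∈ D i ∧ z ∈ W i j ∧ h i j z ∈ D j} := by
    intro i j
    have : {z | z ∈ D i ∧ z ∈ W i j ∧ h i j z ∈ D j} = Cx.ofReal '' (c i '' (B i ∩ B j)) := by
      ext z
      constructor
      · rintro ⟨⟨_, ⟨x, hx, rfl⟩, rfl⟩, h1, h2⟩
        have hxj := hWmem i j x (hBc i hx) h1
        rw [(hWc i j x (hBc i hx) hxj).2] at h2
        exact ⟨_, ⟨x, ⟨hx, hDmem j x hxj h2⟩, rfl⟩, rfl⟩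
      · rintro ⟨_, ⟨x, ⟨hx, hx'⟩, rfl⟩, rfl⟩
        obtain ⟨h1, h2⟩ := hWc i j x (hBc i hx) (hBc j hx')
        exact ⟨⟨_, ⟨x, hx, rfl⟩, rfl⟩, h1, h2 ▸ ⟨_, ⟨x, hx', rfl⟩, rfl⟩⟩
    rw [this]
    exact Cx.isClosedEmbedding_ofReal.isClosedMap _
      (hbA _ _ inter_subset_left ((hbc _).inter (hbc _)))
  have hhol : ∀ i j, HolomorphicAlongLines (h i j) (W i j) := fun i j =>
    (hana i j).holomorphicAlongLines (hW.isOpen i j)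
  have hrefl : ∀ i, ∀ z ∈ D i, z ∈ W i i ∧ ∀ᶠ x in 𝓝 z, h i i x = x := by
    rintro i _ ⟨_, ⟨x, hx, rfl⟩, rfl⟩
    have hxW := (hWc i i x (hBc i hx) (hBc i hx)).1
    refine ⟨hxW, (hhol i i).eventuallyEq_of_eq_ofReal (hW.isOpen i i)
      (holomorphicAlongLines_id _) (fun y hy => ?_) hxW⟩
    obtain ⟨x', h1, h2, rfl⟩ := hWreal i i y hy
    exact (hWc i i x' h1 h2).2
  have htrans : ∀ i j k, ∀ z ∈ D i, z ∈ W i j → h i j z ∈ D j → h i j z ∈ W j k →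
      z ∈ W i k ∧ ∀ᶠ x in 𝓝 z, h i k x = h j k (h i j x) := by
    rintro i j k _ ⟨_, ⟨x, hx, rfl⟩, rfl⟩ h1 - h2
    have hxi := hBc i hx
    have hxj := hWmem i j x hxi h1
    have hij := (hWc i j x hxi hxj).2
    have hxk : x ∈ (c k).source := hWmem j k x hxj (by rwa [hij] at h2)
    have hik := (hWc i k x hxi hxk).1
    have hopen : IsOpen (W i k ∩ (W i j ∩ h i j ⁻¹' W j k)) :=
      (hW.isOpen i k).inter ((hW.continuousOn i j).isOpen_inter_preimage (hW.isOpen i j)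
        (hW.isOpen j k))
    refine ⟨hik, HolomorphicAlongLines.eventuallyEq_of_eq_ofReal hopen
      ((hhol i k).mono inter_subset_left)
      (((hana i j).holomorphicAlongLines_comp (hW.isOpen j k) (hana j k)).mono
        inter_subset_right) ?_ ⟨hik, h1, h2⟩⟩
    rintro y ⟨hy1, hy2, hy3⟩
    obtain ⟨x', h3, h4, rfl⟩ := hWreal i j y hy2
    have h5 := hWmem i k x' h3 hy1
    rw [(hWc i k x' h3 h5).2, (hWc i j x' h3 h4).2, (hWc j k x' h4 h5).2]
  obtain ⟨W', V₀, hW', hW'W, hDW', hDV, hglue₀⟩ := hW.exists_isGluable hDcl hDD hrefl htrans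
  -- Cutting down the real part makes the real points of `V i` exactly those of `c i '' N i`, as an
  -- adapted chart requires.
  let V : Fin t.card → Set (Cx E) := fun i => V₀ i ∩ Cx.re ⁻¹' (c i '' N i)
  have hglue : IsGluable W' h V := hglue₀.mono (fun i => (hglue₀.isOpen i).inter
    (((c i).isOpen_image_of_subset_source (hNo i) (hNc i)).preimage Cx.continuous_re))
    fun i => inter_subset_left
  have hVN : ∀ i, ∀ x ∈ N i, Cx.ofReal (c i x) ∈ V i := fun i x hx =>
    ⟨hDV i ⟨_, ⟨x, hNB i hx, rfl⟩, rfl⟩, ⟨x, hx, rfl⟩⟩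
  have hNV : ∀ i u, Cx.ofReal u ∈ V i → u ∈ c i '' N i := fun i u hu => hu.2
  have hne : ∀ i, (V i).Nonempty := fun i => ⟨_, hVN i _ (hpN i)⟩
  let ψ : Fin t.card → OpenPartialHomeomorph (GluedSpace hW' hglue) (Cx E) := fun i =>
    GluedSpace.chart hW' hglue i (hne i)
  have hψsymm : ∀ i z (hz : z ∈ V i), (ψ i).symm z = GluedSpace.incl hW' hglue i ⟨z, hz⟩ :=
    fun i z hz => GluedSpace.chart_symm_apply hW' hglue i (hne i) hz
  have hψt : ∀ i, (ψ i).target = V i := fun i => GluedSpace.chart_target hW' hglue i (hne i)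
  have hψeq : ∀ i j, ∀ z ∈ V i, ∀ w ∈ V j,
      (ψ i).symm z = (ψ j).symm w ↔ z ∈ W' i j ∧ h i j z = w := by
    intro i j z hz w hw
    rw [hψsymm i z hz, hψsymm j w hw]
    exact GluedSpace.incl_eq_incl_iff hW' hglue
  have hchange : ∀ i j, ∀ z ∈ V i, (ψ i).symm z ∈ (ψ j).source →
      z ∈ W' i j ∧ ψ j ((ψ i).symm z) = h i j z := by
    intro i j z hz hzj
    have hw : ψ j ((ψ i).symm z) ∈ V j := hψt j ▸ (ψ j).map_source hzj
    obtain ⟨h1, h2⟩ := (hψeq i j z hz _ hw).1 ((ψ j).left_inv hzj).symm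
    exact ⟨h1, h2.symm⟩
  let Ω : TopologicalSpace.Opens M := ⟨⋃ i, N i, isOpen_iUnion hNo⟩
  have hΩ : ∀ y : Ω, ∃ i, (y : M) ∈ N i := fun y => mem_iUnion.1 y.2
  choose k hk using hΩ
  let φ : Ω → GluedSpace hW' hglue := fun y => (ψ (k y)).symm (Cx.ofReal (c (k y) y))
  have hφeq : ∀ i (y : Ω), (y : M) ∈ N i → φ y = (ψ i).symm (Cx.ofReal (c i y)) := by
    intro i y hy
    have h1 := hWc (k y) i y (hNc _ (hk y)) (hNc _ hy)
    refine (hψeq (k y) i _ (hVN _ _ (hk y)) _ (hVN _ _ hy)).2 ⟨?_, h1.2⟩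
    refine hDW' (k y) i _ ⟨_, ⟨y, hNB _ (hk y), rfl⟩, rfl⟩ h1.1 ?_
    rw [h1.2]
    exact ⟨_, ⟨y, hNB _ hy, rfl⟩, rfl⟩
  have hφN : ∀ i (y : Ω), φ y ∈ (ψ i).source ↔ (y : M) ∈ N i := by
    intro i y
    constructor
    · intro hy
      obtain ⟨h1, h2⟩ := hchange (k y) i _ (hVN _ _ (hk y)) hy
      have hyk := hNc _ (hk y)
      have hyi := hWmem (k y) i y hyk (hW'W _ _ h1)
      rw [(hWc (k y) i y hyk hyi).2] at h2
      have h3 : Cx.ofReal (c i y) ∈ V i := by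
        rw [← h2, ← hψt i]
        exact (ψ i).map_source hy
      obtain ⟨x, hx, hxy⟩ := hNV i _ h3
      rwa [← (c i).injOn (hNc i hx) hyi hxy]
    · intro hy
      rw [hφeq i y hy]
      exact (ψ i).map_target (hψt i ▸ hVN i y hy)
  have hφ : ∀ i (y : Ω), (y : M) ∈ N i → ψ i (φ y) = Cx.ofReal (c i y) := by
    intro i y hy
    rw [hφeq i y hy]
    exact (ψ i).right_inv (hψt i ▸ hVN i y hy)
  have hcover : ⋃ i, (ψ i).source = univ := by
    refine eq_univ_of_forall fun x => ?_
    obtain ⟨i, z, rfl⟩ := GluedSpace.exists_incl_eq hW' hglue x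
    refine mem_iUnion.2 ⟨i, ?_⟩
    rw [← hψsymm i z z.2]
    exact (ψ i).map_target ((hψt i).symm ▸ z.2 : (z : Cx E) ∈ (ψ i).target)
  have hψ : ∀ i j, ComplexAnalyticOn ((ψ i).symm ≫ₕ ψ j) ((ψ i).symm ≫ₕ ψ j).source := by
    intro i j
    have key : ∀ z ∈ ((ψ i).symm ≫ₕ ψ j).source, z ∈ W' i j ∧ ψ j ((ψ i).symm z) = h i j z :=
      fun z hz => hchange i j z (hψt i ▸ hz.1) hz.2
    exact (hana i j).mono_congr ((ψ i).symm ≫ₕ ψ j).open_source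
      (fun z hz => hW'W i j (key z hz).1) fun z hz => (key z hz).2
  obtain ⟨cs, h1, h2⟩ := exists_isComplexification_of_charts (Ω := Ω) (φ := φ) hM hc hNo hNc
    (fun i => subset_iUnion N i) (fun i => ⟨_, hpN i⟩) subset_rfl hφN hφ
    (fun i u hu => hNV i u (hψt i ▸ hu)) hcover hψ
  refine ⟨Ω, fun x hx => ?_, GluedSpace hW' hglue, inferInstance, cs, φ, h1, inferInstance, h2⟩
  obtain ⟨y, hy, hxy⟩ := mem_iUnion₂.1 (hKt hx)
  refine mem_iUnion.2 ⟨t.equivFin ⟨y, hy⟩, ?_⟩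
  simpa [N, B, p] using hxy
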